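/- Let $V$ be a finite-dimensional complex vector space and $G\subset GL(V)$ a finite subgroup. For $s\in G$ put $V^s=\ker(\mathrm{id}-s)$, and let $\mathcal S'$ be the set of all $s\in G$ with $\operatorname{rank}(\mathrm{id}-s)=2$ such that $\det(g|_{V/V^s})=1$ for every $g$ in the centraliser $Z_G(s)$. Assume that $G$ is generated by $\mathcal S'$. For $s\in\mathcal S'$ let $\Omega_s$ be a skew-symmetric bilinear form on $V$ with radical exactly $V^s$ (unique up to a nonzero scalar), chosen so that $\Omega_{g^{-1}sg}(v,w)=\Omega_s(gv,gw)$ for all $g\in G$ and $v,w\in V$. Let $b_1,\dots,b_N$ be a basis of the space $((\bigwedge^2V)^*)^G$ of $G$-invariant skew-symmetric bilinear forms on $V$, let $\mathbf t=(t_1,\dots,t_N)\in\mathbb C^N$, and let $\mathbf c:\mathcal S'\to\mathbb C$, $s\mapsto c_s$, be invariant under conjugation by $G$. Put $$\kappa(v,w)=\sum_{i=1}^N t_i b_i(v,w)\,\mathrm{id}+\sum_{s\in\mathcal S'}c_s\Omega_s(v,w)\,s\in\mathbb CG,$$ and let $$A=A_{\mathbf t,\mathbf c}=\bigl(T(V)\ast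 G\bigr)/\langle vw-wv-\kappa(v,w):v,w\in V\rangle$$ be the graded Hecke algebra, where $T(V)\ast G$ is the skew group algebra of the tensor algebra. Let $e=\frac1{|G|}\sum_{g\in G}g\in A$. Suppose that the spherical subalgebra $eAe$ is commutative. Then there is a nonempty Zariski-open subset $\mathcal M$ of the set $\mathrm{MaxSpec}(eAe)$ of maximal ideals of $eAe$ such that for every $\mathfrak m\in\mathcal M$ the induced $A$-module $T_{\mathfrak m}=Ae\otimes_{eAe}(eAe/\mathfrak m)$ is isomorphic, as a $G$-module (that is, as a $\mathbb CG$-module), to the regular representation $\mathbb CG$. -/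

import Mathlib

noncomputable section

namespace GradedHecke

variable {V : Type*} [AddCommGroup V] [Module ℂ V]

/-- The fixed space `V^g = ker (id - g)` of `g ∈ GL(V)`. -/
def fixedSpace (g : LinearMap.GeneralLinearGroup ℂ V) : Submodule ℂ V :=
  LinearMap.ker (1 - (g : Module.End ℂ V))

/-- An element commuting with `s` stabilises `V^s`. -/
theorem fixedSpace_le_comap {s g : LinearMap.GeneralLinearGroup ℂ V} (h : Commute g s) :
    fixedSpace s ≤ (fixedSpace s).comap (g : Module.End ℂ V) := by
  intro v hv
  have hc : (g : Module.End ℂ V) * (s : Module.End ℂ V) = s * g := congrArg Units.val h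
  have hcv : (g : Module.End ℂ V) ((s : Module.End ℂ V) v)
      = (s : Module.End ℂ V) ((g : Module.End ℂ V) v) := LinearMap.congr_fun hc v
  simp only [fixedSpace, LinearMap.mem_ker, LinearMap.sub_apply, Module.End.one_apply,
    Submodule.mem_comap] at hv ⊢
  rw [← hcv, ← sub_eq_zero.mp hv, sub_self]

/-- The endomorphism of `V / V^s` induced by an element commuting with `s`. -/
def quotientMap (s g : LinearMap.GeneralLinearGroup ℂ V) (h : Commute g s) :
    Module.End ℂ (V ⧸ fixedSpace s) :=
  (fixedSpace s).mapQ (fixedSpace s) (g : Module.End ℂ V) (fixedSpace_le_comap h)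

variable (G : Subgroup (LinearMap.GeneralLinearGroup ℂ V))

/-- The set `𝒮` of bireflections in `G`: the elements `s` with `rank (id - s) = 2`. -/
def bireflections : Set G :=
  {s | Module.finrank ℂ
    (LinearMap.range (1 - ((s : LinearMap.GeneralLinearGroup ℂ V) : Module.End ℂ V))) = 2}

/-- The set of bireflections `s` such that every element of the centraliser `Z_G(s)` acts on
`V / V^s` with determinant `1`. -/
def admissible : Set G :=
  {s | s ∈ bireflections G ∧
    ∀ (g : G) (h : Commute (g : LinearMap.GeneralLinearGroup ℂ V) s),
      LinearMap.det (quotientMap _ _ h) = 1}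

/-- The space `((⋀² V)^*)^G` of `G`-invariant skew-symmetric bilinear forms on `V`. -/
def invariantForms : Submodule ℂ (LinearMap.BilinForm ℂ V) where
  carrier := {ω | ω.IsAlt ∧ ∀ (g : G) (v w : V), ω (g • v) (g • w) = ω v w}
  zero_mem' := ⟨fun _ => rfl, fun _ _ _ => rfl⟩
  add_mem' := fun ha hb =>
    ⟨fun v => by simp [ha.1 v, hb.1 v], fun g v w => by simp [ha.2 g v w, hb.2 g v w]⟩
  smul_mem' := fun r _ ha => ⟨fun v => by simp [ha.1 v], fun g v w => by simp [ha.2 g v w]⟩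

/-- A choice of the forms `Ω_s` for the admissible bireflections `s`: each `Ω_s` is
skew-symmetric with radical `ker (id - s)` (so it is nonzero on the plane `im (id - s)`, and
unique up to a nonzero scalar), and `Ω_{g⁻¹sg}(v, w) = Ω_s(g v, g w)`. -/
structure BireflectionForms where
  form : admissible G → LinearMap.BilinForm ℂ V
  isAlt : ∀ s, (form s).IsAlt
  radical : ∀ s, LinearMap.ker (form s) = fixedSpace (s : G)
  conj : ∀ (g : G) (s s₁ : admissible G), (s₁ : G) = g⁻¹ * s * g →
    ∀ v w : V, form s₁ v w = form s (g • v) (g • w)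

/-- The form `κ(v, w) = Ω(v, w) id + ∑ₛ cₛ Ωₛ(v, w) s` with values in `ℂG`, where
`Ω = ∑ᵢ tᵢ bᵢ` and `s` runs through the admissible bireflections. -/
def kappa {N : ℕ} (b : Fin N → LinearMap.BilinForm ℂ V) (t : Fin N → ℂ)
    (Ω : BireflectionForms G) (c : admissible G → ℂ) (v w : V) : MonoidAlgebra ℂ G :=
  MonoidAlgebra.single 1 (∑ i, t i * b i v w)
    + ∑ᶠ s : admissible G, MonoidAlgebra.single (s : G) (c s * Ω.form s v w)

/-- The action of `G` on the tensor algebra `T(V)` by algebra automorphisms extending its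
action on `V`. -/
instance tensorAction : MulSemiringAction G (TensorAlgebra ℂ V) where
  smul g x := TensorAlgebra.lift ℂ
    (TensorAlgebra.ι ℂ ∘ₗ ((g : LinearMap.GeneralLinearGroup ℂ V) : Module.End ℂ V)) x
  one_smul x := by
    change TensorAlgebra.lift ℂ _ x = AlgHom.id ℂ _ x
    congr 1
    ext v
    simp
  mul_smul g h x := by
    change TensorAlgebra.lift ℂ _ x
      = ((TensorAlgebra.lift ℂ _).comp (TensorAlgebra.lift ℂ _) : _ →ₐ[ℂ] _) x
    congr 1
    ext v
    simp
  smul_zero _ := map_zero _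
  smul_add _ := map_add _
  smul_one _ := map_one _
  smul_mul _ := map_mul _

theorem tensorAction_ι (g : G) (v : V) :
    g • TensorAlgebra.ι ℂ v = TensorAlgebra.ι ℂ (g • v) :=
  TensorAlgebra.lift_ι_apply _ _

instance : SMulCommClass G ℂ (TensorAlgebra ℂ V) where
  smul_comm _ r x := map_smul (TensorAlgebra.lift ℂ _) r x

/-- The skew group algebra `T(V) ∗ G`, with `g x = (g • x) g` for `g ∈ G`, `x ∈ T(V)`. -/
abbrev SkewGroupAlgebra : Type _ := SkewMonoidAlgebra (TensorAlgebra ℂ V) G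

/-- The inclusion of `ℂG` in `T(V) ∗ G`. -/
def groupAlgebraToSkew : MonoidAlgebra ℂ G →ₐ[ℂ] SkewGroupAlgebra G :=
  MonoidAlgebra.lift ℂ _ G (SkewMonoidAlgebra.of (TensorAlgebra ℂ V) G)

/-- The element `v` of `V ⊆ T(V) ∗ G`. -/
def vec (v : V) : SkewGroupAlgebra G := SkewMonoidAlgebra.single 1 (TensorAlgebra.ι ℂ v)

variable (κ : V → V → MonoidAlgebra ℂ G)

/-- The relations `[v, w] = κ(v, w)`. -/
inductive Rel : SkewGroupAlgebra G → SkewGroupAlgebra G → Prop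
  | comm (v w : V) : Rel (vec G v * vec G w - vec G w * vec G v) (groupAlgebraToSkew G (κ v w))

/-- The algebra `A = (T(V) ∗ G) / ⟨[v, w] - κ(v, w) : v, w ∈ V⟩`. -/
def HeckeAlgebra : Type _ := RingQuot (Rel G κ)

instance : Ring (HeckeAlgebra G κ) := inferInstanceAs (Ring (RingQuot (Rel G κ)))

instance : Algebra ℂ (HeckeAlgebra G κ) := inferInstanceAs (Algebra ℂ (RingQuot (Rel G κ)))

/-- The quotient map `T(V) ∗ G → A`. -/
def quotHom : SkewGroupAlgebra G →ₐ[ℂ] HeckeAlgebra G κ := RingQuot.mkAlgHom ℂ (Rel G κ)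

/-- The canonical map `ℂG → A`. -/
def groupAlgebraHom : MonoidAlgebra ℂ G →ₐ[ℂ] HeckeAlgebra G κ :=
  (quotHom G κ).comp (groupAlgebraToSkew G)

/-- The symmetrizing idempotent `|G|⁻¹ ∑ g` of `ℂG`. -/
def symIdem : MonoidAlgebra ℂ G :=
  (Nat.card G : ℂ)⁻¹ • ∑ᶠ g : G, MonoidAlgebra.of ℂ G g

/-- The symmetrizing idempotent `e`, as an element of `A`. -/
def idem : HeckeAlgebra G κ := groupAlgebraHom G κ (symIdem G)

theorem symIdem_isIdempotentElem [Finite G] : IsIdempotentElem (symIdem G) := by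
  classical
  have := Fintype.ofFinite G
  have hsum : ∀ g : G, MonoidAlgebra.of ℂ G g * ∑ h : G, MonoidAlgebra.of ℂ G h
      = ∑ h : G, MonoidAlgebra.of ℂ G h := by
    intro g
    rw [Finset.mul_sum]
    simp_rw [← map_mul]
    exact Fintype.sum_equiv (Equiv.mulLeft g) _ _ (fun _ => rfl)
  have hcard : (Fintype.card G : ℂ) ≠ 0 := Nat.cast_ne_zero.mpr Fintype.card_ne_zero
  have hsq : (∑ h : G, MonoidAlgebra.of ℂ G h) * ∑ h : G, MonoidAlgebra.of ℂ G h
      = (Fintype.card G : ℂ) • ∑ h : G, MonoidAlgebra.of ℂ G h := by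
    rw [Finset.sum_mul]
    simp_rw [hsum]
    rw [Finset.sum_const, Finset.card_univ, Nat.cast_smul_eq_nsmul]
  unfold IsIdempotentElem symIdem
  rw [finsum_eq_sum_of_fintype, Nat.card_eq_fintype_card, smul_mul_smul_comm, hsq, smul_smul]
  congr 1
  field_simp

theorem idem_isIdempotentElem [Finite G] : IsIdempotentElem (idem G κ) := by
  unfold idem IsIdempotentElem
  rw [← map_mul, (symIdem_isIdempotentElem G).eq]

section Spherical

variable [Finite G]

/-- The spherical subalgebra `eAe`, with identity `e`. -/
abbrev Spherical : Type _ := (idem_isIdempotentElem G κ).Corner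

/-- The left ideal `Ae` of `A`. -/
abbrev LeftIdeal : Type _ := (Ideal.span {idem G κ} : Ideal (HeckeAlgebra G κ))

instance [IsMulCommutative (Spherical G κ)] : CommRing (Spherical G κ) where
  __ := (inferInstance : Ring (Spherical G κ))
  mul_comm a b := isMulCommutative_iff.mp inferInstance a b

/-- The right `eAe`-module structure of `Ae` by right multiplication; as `eAe` is commutative
it is written on the left, `b • x = x b`. -/
instance [IsMulCommutative (Spherical G κ)] : Module (Spherical G κ) (LeftIdeal G κ) where
  smul b x := ⟨x.1 * b.1, by
    obtain ⟨r, hr⟩ := b.2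
    rw [← hr]
    exact Ideal.mem_span_singleton'.mpr ⟨x.1 * (idem G κ * r), by simp only [mul_assoc]⟩⟩
  one_smul x := Subtype.ext <| by
    obtain ⟨a, ha⟩ := Ideal.mem_span_singleton'.mp x.2
    change x.1 * idem G κ = x.1
    rw [← ha, mul_assoc, (idem_isIdempotentElem G κ).eq]
  mul_smul a b x := Subtype.ext <| by
    change x.1 * (a * b).1 = x.1 * b.1 * a.1
    rw [mul_comm a b]
    exact (mul_assoc x.1 b.1 a.1).symm
  smul_zero b := Subtype.ext (zero_mul b.1)
  smul_add b x y := Subtype.ext (add_mul x.1 y.1 b.1)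
  add_smul a b x := Subtype.ext (mul_add x.1 a.1 b.1)
  zero_smul x := Subtype.ext (mul_zero x.1)

instance [IsMulCommutative (Spherical G κ)] :
    SMulCommClass (Spherical G κ) (HeckeAlgebra G κ) (LeftIdeal G κ) where
  smul_comm b a x := Subtype.ext (mul_assoc a x.1 b.1)

/-- The induced module `T_𝔪 = Ae ⊗_{eAe} (eAe / 𝔪)`. -/
def InducedModule [IsMulCommutative (Spherical G κ)] (m : Ideal (Spherical G κ)) : Type _ :=
  TensorProduct (Spherical G κ) (LeftIdeal G κ) (Spherical G κ ⧸ m)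

variable [IsMulCommutative (Spherical G κ)] (m : Ideal (Spherical G κ))

instance : AddCommGroup (InducedModule G κ m) :=
  inferInstanceAs
    (AddCommGroup (TensorProduct (Spherical G κ) (LeftIdeal G κ) (Spherical G κ ⧸ m)))

instance : SMulCommClass (HeckeAlgebra G κ) (Spherical G κ) (LeftIdeal G κ) :=
  SMulCommClass.symm _ _ _

/-- The left `A`-module structure of `T_𝔪`, through the left factor. -/
instance : Module (HeckeAlgebra G κ) (InducedModule G κ m) :=
  inferInstanceAs (Module (HeckeAlgebra G κ)
    (TensorProduct (Spherical G κ) (LeftIdeal G κ) (Spherical G κ ⧸ m)))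

/-- The `G`-module structure of `T_𝔪`: restriction along `ℂG → A`. -/
instance : Module (MonoidAlgebra ℂ G) (InducedModule G κ m) :=
  Module.compHom _ (groupAlgebraHom G κ).toRingHom

end Spherical

end GradedHecke

end

/-!
The module `Ae` is a deformation of `S(V)`, on which `eAe` acts as a deformation of `S(V)^G`; over
the points with a free `G`-orbit the fibres of `S(V)` over `S(V)^G` are regular representations of
`G`, and this property survives the deformation at generic points.

*Normal form.* The bracket `κ = ∑ₛ Kₛ(·,·) s` is skew, `G`-equivariant and satisfies the Jacobi
identity `Kₛ(x, y) (s z - z) + cyclic = 0`: for a bireflection `s` three vectors are dependent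
modulo `V^s = rad Ωₛ` (`jacobi_of_ker_eq_fixedSpace`). For such a bracket, words in a basis of `V`
can be sorted by the rule `v w = w v + κ(v, w)`, group elements being moved to the right end and
dropped there, in a way that does not depend on the order of the exchanges. The correction incurred
by sorting a word is `sortCost`; its independence of the exchanges is the theorem
`sortCost_exchange`, whose hypotheses are the cocycle conditions `IsExchangeCocycle`. The resulting
`normalForm : T(V) → S(V)` factors through `T(V) → Ae`, `t ↦ t e`, and gives a linear isomorphism
`leftIdealEquiv : Ae ≃ S(V)`, the Poincaré–Birkhoff–Witt theorem for `Ae`.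

*Deformation.* Every correction lowers the degree, so up to terms of lower degree `leftIdealEquiv`
takes the action of `eAe` to multiplication by invariant polynomials and the action of `G` to the
linear one. The structure `IsDeformation` records this, and all further arguments use only it.
Leading terms show that `eAe` is a domain, that each homogeneous invariant is the leading term of an
element of `eAe`, and that `eAe` is a finitely generated algebra, so its residue fields are `ℂ`.

*A generic basis.* Let `Eⁱ_{ac}` be matrix units of `ℂG`. The values on a free orbit identify a
quotient of `S(V)` with `ℂG`, and homogeneous polynomials `q i c ∈ Eⁱ₀₀ S(V)` can be chosen whose
values form a basis of `Eⁱ₀₀ ℂG` (`exists_homogeneous_seeds`). By Cramer's rule the `|G|`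
polynomials `Eⁱ_{a0} q i c` are independent over `S(V)^G`, and span `S(V)` up to a discriminant `D`
(`IsLinearAction.exists_discriminant`). Lifts `u i c ∈ Eⁱ₀₀ Ae` of the `q i c` add up to an element
`U = ∑ Eⁱ_{c0} u i c` with `Eⁱ_{ac} U = Eⁱ_{a0} u i c`, and the leading terms of these elements are
the polynomials above. Hence the `Eⁱ_{ac} U` are independent over `eAe`, and they span `Ae` after
multiplication by some `f ≠ 0` in `eAe`. The latter holds because generators `mᵢ` of `Ae` satisfy
`β mᵢ ≡ ∑ₖ Cᵢₖ mₖ` modulo the span, where `β` lifts `D` and `C` has lower degree, so that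
`f = det (β - C)` is nonzero (`IsDeformation.exists_ne_zero_smul_mem_span`).

If `f ∉ 𝔪`, then `a ↦ a (U ⊗ 1)` is an isomorphism of `ℂG` with `T_𝔪`. The set of these `𝔪` is open,
and it is nonempty because an element of the Jacobson radical of `eAe` vanishes: the units of `eAe`
have degree zero.
-/

noncomputable section

namespace GradedHecke

/-! ### Rewriting words by insertion sort -/

section Sorting

variable {X N : Type*} [AddCommGroup N]

/-- The conditions under which the costs `f u x y w` of the exchanges `u x y w → u y x w` add up
to a function of the words alone: exchanging twice costs nothing, exchanges at disjoint places
commute, and the two ways of reversing three consecutive letters cost the same. -/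
structure IsExchangeCocycle (f : List X → X → X → List X → N) : Prop where
  self : ∀ u x w, f u x x w = 0
  anti : ∀ u x y w, f u x y w = -f u y x w
  comm : ∀ u x y m p q w,
    f u x y (m ++ p :: q :: w) - f u x y (m ++ q :: p :: w)
      = f (u ++ x :: y :: m) p q w - f (u ++ y :: x :: m) p q w
  braid : ∀ u x y z w,
    f u x y (z :: w) + f (u ++ [y]) x z w + f u y z (x :: w)
      = f (u ++ [x]) y z w + f u x z (y :: w) + f (u ++ [z]) x y w

variable {f g : List X → X → X → List X → N}

theorem IsExchangeCocycle.cons (hf : IsExchangeCocycle f) (z : X) :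
    IsExchangeCocycle fun u => f (z :: u) where
  self u := hf.self (z :: u)
  anti u := hf.anti (z :: u)
  comm u := hf.comm (z :: u)
  braid u := hf.braid (z :: u)

variable [LinearOrder X]

/-- The cost of inserting `x` into the word `w` by adjacent transpositions, where
`f u x y w` is the cost of replacing `u x y w` by `u y x w`. -/
def insCost (f : List X → X → X → List X → N) (x : X) : List X → N
  | [] => 0
  | y :: w => if x ≤ y then 0 else f [] x y w + insCost (fun u => f (y :: u)) x w

/-- The cost of sorting a word by insertion sort. -/
def sortCost (f : List X → X → X → List X → N) : List X → N
  | [] => 0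
  | x :: w => sortCost (fun u => f (x :: u)) w + insCost f x (w.insertionSort (· ≤ ·))

/-- Costs that differ by a coboundary `h` have insertion costs that differ by `h`. -/
theorem insCost_sub (h : List X → N) (x : X) (s : List X)
    (H : ∀ u p q w, f u p q w - g u p q w = h (u ++ p :: q :: w) - h (u ++ q :: p :: w)) :
    insCost f x s - insCost g x s = h (x :: s) - h (s.orderedInsert (· ≤ ·) x) := by
  induction s generalizing f g h with
  | nil => simp [insCost]
  | cons y s ih =>
    simp only [insCost, List.orderedInsert]
    split_ifs with hxy
    · simp
    · have h1 := H [] x y s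
      have h2 := ih (f := fun u => f (y :: u)) (g := fun u => g (y :: u)) (fun w => h (y :: w))
        (fun u p q w => H (y :: u) p q w)
      simp only [List.nil_append] at h1
      rw [add_sub_add_comm, h1, h2]
      abel

theorem sortCost_sub (h : List X → N) (s : List X)
    (H : ∀ u p q w, f u p q w - g u p q w = h (u ++ p :: q :: w) - h (u ++ q :: p :: w)) :
    sortCost f s - sortCost g s = h s - h (s.insertionSort (· ≤ ·)) := by
  induction s generalizing f g h with
  | nil => simp [sortCost]
  | cons y s ih =>
    have h1 := ih (f := fun u => f (y :: u)) (g := fun u => g (y :: u)) (fun w => h (y :: w))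
        (fun u p q w => H (y :: u) p q w)
    have h2 := insCost_sub h y (s.insertionSort (· ≤ ·)) H
    simp only [sortCost, List.insertionSort_cons]
    rw [add_sub_add_comm, h1, h2]
    abel

/-- The two ways to insert `x` and `y` into a word differ in cost by the exchange of `x` and `y`;
when both pass a letter `z`, this is the condition `braid`. -/
theorem insCost_exchange (hf : IsExchangeCocycle f) (x y : X) (s : List X) :
    insCost (fun u => f (x :: u)) y s + insCost f x (s.orderedInsert (· ≤ ·) y)
      - insCost (fun u => f (y :: u)) x s - insCost f y (s.orderedInsert (· ≤ ·) x)
      = f [] x y s := by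
  induction s generalizing f with
  | nil =>
    rcases lt_trichotomy x y with h | rfl | h
    · simp [insCost, h.le, h.not_ge, ← hf.anti]
    · simp [insCost, hf.self]
    · simp [insCost, h.le, h.not_ge]
  | cons z s ih =>
    rcases le_or_gt x z with hx | hx <;> rcases le_or_gt y z with hy | hy
    · rcases lt_trichotomy x y with h | rfl | h
      · simp [insCost, hx, hy, h.le, h.not_ge, ← hf.anti]
      · simp [insCost, hf.self]
      · simp [insCost, hx, hy, h.le, h.not_ge]
    · have h := hx.trans_lt hy
      have hxy := hf.anti [] x y (z :: s)
      simp only [insCost, hx, hy.not_ge, h.not_ge, List.orderedInsert, if_true, if_false]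
      rw [hxy]; abel
    · have h := hy.trans_lt hx
      simp only [insCost, hy, hx.not_ge, h.not_ge, List.orderedInsert, if_true, if_false]
      abel
    · have h1 := ih (hf.cons z)
      have h2 := insCost_sub (f := fun u => f (x :: z :: u)) (g := fun u => f (z :: x :: u))
        (fun w => f [] x z w) y s (fun u p q w => by
          simpa using (hf.comm [] x z u p q w).symm)
      have h3 := insCost_sub (f := fun u => f (y :: z :: u)) (g := fun u => f (z :: y :: u))
        (fun w => f [] y z w) x s (fun u p q w => by
          simpa using (hf.comm [] y z u p q w).symm)
      have h4 := hf.braid [] x y z s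
      simp only [List.nil_append] at h4
      simp only [insCost, hx.not_ge, hy.not_ge, List.orderedInsert, if_false]
      rw [sub_eq_iff_eq_add] at h2 h3
      rw [h2, h3]
      rw [← sub_eq_zero] at h1 h4 ⊢
      rw [← h1, ← sub_eq_zero, ← neg_eq_zero, ← h4]
      abel

/-- The cost of sorting changes under an exchange of adjacent letters by the cost of that
exchange. -/
theorem sortCost_exchange (hf : IsExchangeCocycle f) (u : List X) (x y : X) (w : List X) :
    sortCost f (u ++ x :: y :: w) - sortCost f (u ++ y :: x :: w) = f u x y w := by
  induction u generalizing f with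
  | nil =>
    have h1 := sortCost_sub (f := fun u => f (x :: y :: u)) (g := fun u => f (y :: x :: u))
      (fun w => f [] x y w) w (fun u p q w => by simpa using (hf.comm [] x y u p q w).symm)
    have h2 := insCost_exchange hf x y (w.insertionSort (· ≤ ·))
    simp only [List.nil_append, sortCost, List.insertionSort_cons]
    rw [← sub_eq_zero] at h1 h2 ⊢
    rw [← add_zero (0 : N)]
    nth_rw 1 [← h1]
    nth_rw 1 [← h2]
    abel
  | cons z u ih =>
    have hs : (u ++ x :: y :: w).insertionSort (· ≤ ·)
        = (u ++ y :: x :: w).insertionSort (· ≤ ·) := by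
      refine List.Perm.eq_of_pairwise (le := (· ≤ ·)) (fun a b _ _ h h' => le_antisymm h h')
        (List.pairwise_insertionSort _ _) (List.pairwise_insertionSort _ _) ?_
      exact (List.perm_insertionSort _ _).trans
        (((List.Perm.swap y x w).append_left u).trans (List.perm_insertionSort _ _).symm)
    simp only [List.cons_append, sortCost, hs, add_sub_add_right_eq_sub]
    exact ih (hf.cons z)

theorem sortCost_eq_zero {s : List X} (hs : s.Pairwise (· ≤ ·)) : sortCost f s = 0 := by
  induction s generalizing f with
  | nil => rfl
  | cons x s ih =>
    rw [List.pairwise_cons] at hs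
    rw [sortCost, ih hs.2, List.Pairwise.insertionSort_eq hs.2, zero_add]
    cases s with
    | nil => rfl
    | cons y s => simp [insCost, hs.1 y]

theorem insCost_mem {R : Type*} [Semiring R] [Module R N] (P : Submodule R N) (x : X)
    (s : List X) (H : ∀ u x y w, u.length + w.length + 1 = s.length → f u x y w ∈ P) :
    insCost f x s ∈ P := by
  induction s generalizing f with
  | nil => exact P.zero_mem
  | cons y s ih =>
    rw [insCost]
    split_ifs
    · exact P.zero_mem
    · exact P.add_mem (H _ _ _ _ (by simp)) (ih fun u x y w h => H _ _ _ _ (by simp; omega))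

theorem sortCost_mem {R : Type*} [Semiring R] [Module R N] (P : Submodule R N)
    (s : List X) (H : ∀ u x y w, u.length + w.length + 2 = s.length → f u x y w ∈ P) :
    sortCost f s ∈ P := by
  induction s generalizing f with
  | nil => exact P.zero_mem
  | cons x s ih =>
    refine P.add_mem (ih fun u x y w h => H _ _ _ _ (by simp; omega)) (insCost_mem P x _ ?_)
    intro u x y w h
    refine H _ _ _ _ ?_
    simp only [List.length_insertionSort, List.length_cons] at h ⊢
    omega

end Sorting

/-! ### Straightening in the tensor algebra -/

section Straightening

open TensorAlgebra

variable {V : Type*} [AddCommGroup V] [Module ℂ V]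
  {G : Subgroup (LinearMap.GeneralLinearGroup ℂ V)}
  {X : Type*} (b : Module.Basis X ℂ V)
  (K : G → LinearMap.BilinForm ℂ V)
  {N : Type*} [AddCommGroup N] [Module ℂ N]

/-- The conditions on a bracket `[v, w] = ∑ₛ Kₛ(v, w) s` with values in `ℂG` under which words
can be straightened consistently: skew symmetry, `G`-equivariance, and the Jacobi identity. -/
structure IsGroupBracket : Prop where
  alt : ∀ s, (K s).IsAlt
  conj : ∀ g s v w, K (g⁻¹ * s * g) v w = K s (g • v) (g • w)
  jacobi : ∀ (s : G) (x y z : V),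
    K s x y • (s • z - z) + K s z x • (s • y - y) + K s y z • (s • x - x) = 0

/-- The product in `T(V)` of a word in the basis vectors. -/
def word (w : List X) : TensorAlgebra ℂ V := (w.map fun i => ι ℂ (b i)).prod

@[simp] theorem word_nil : word b [] = 1 := rfl

@[simp] theorem word_cons (x : X) (w : List X) : word b (x :: w) = ι ℂ (b x) * word b w := by
  simp [word]

@[simp] theorem word_append (u w : List X) : word b (u ++ w) = word b u * word b w := by
  simp [word]

theorem tensorAlgebra_basis_apply (w : FreeMonoid X) : b.tensorAlgebra w = word b w.toList := by
  have hb : ∀ w, b.tensorAlgebra w = (equivFreeAlgebra b).symm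
      (FreeAlgebra.equivMonoidAlgebraFreeMonoid.symm (MonoidAlgebra.of ℂ _ w)) := by
    intro w
    simp [Module.Basis.tensorAlgebra, FreeAlgebra.basisFreeMonoid]
  induction w using FreeMonoid.inductionOn' with
  | one => rw [hb, map_one, map_one, map_one]; rfl
  | of_mul x w ih =>
    rw [FreeMonoid.toList_of_mul, word_cons, ← ih, hb, hb, map_mul, map_mul, map_mul]
    congr 1
    rw [← equivFreeAlgebra_symm_ι]
    congr 1
    simp [FreeAlgebra.equivMonoidAlgebraFreeMonoid]

/-- The linear map on `T(V)` with prescribed values on words. -/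
def onWords (f : List X → N) : TensorAlgebra ℂ V →ₗ[ℂ] N :=
  b.tensorAlgebra.constr ℂ fun w => f w.toList

@[simp] theorem onWords_word (f : List X → N) (w : List X) : onWords b f (word b w) = f w := by
  have := b.tensorAlgebra.constr_basis ℂ (fun w => f w.toList) (FreeMonoid.ofList w)
  rwa [tensorAlgebra_basis_apply] at this

/-- The span of the words of length at most `n`. -/
def wordsLE (n : ℕ) : Submodule ℂ (TensorAlgebra ℂ V) :=
  Submodule.span ℂ {t | ∃ w : List X, w.length ≤ n ∧ word b w = t}

theorem word_mem_wordsLE {w : List X} {n : ℕ} (h : w.length ≤ n) : word b w ∈ wordsLE b n :=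
  Submodule.subset_span ⟨w, h, rfl⟩

theorem wordsLE_mono {m n : ℕ} (h : m ≤ n) : wordsLE b m ≤ wordsLE b n :=
  Submodule.span_mono fun _ ⟨w, hw, e⟩ => ⟨w, hw.trans h, e⟩

theorem mul_mem_wordsLE {m n : ℕ} {s t : TensorAlgebra ℂ V} (hs : s ∈ wordsLE b m)
    (ht : t ∈ wordsLE b n) : s * t ∈ wordsLE b (m + n) := by
  have h := Submodule.mul_mem_mul hs ht
  rw [wordsLE, wordsLE, Submodule.span_mul_span] at h
  refine Submodule.span_mono ?_ h
  rintro _ ⟨_, ⟨u, hu, rfl⟩, _, ⟨w, hw, rfl⟩, rfl⟩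
  exact ⟨u ++ w, by simp; omega, by simp⟩

theorem span_words : Submodule.span ℂ (Set.range (word b)) = ⊤ := by
  rw [← b.tensorAlgebra.span_eq]
  congr 1
  ext t
  simp only [Set.mem_range, tensorAlgebra_basis_apply]
  exact ⟨fun ⟨w, h⟩ => ⟨FreeMonoid.ofList w, h⟩, fun ⟨w, h⟩ => ⟨w.toList, h⟩⟩

theorem ι_mem_wordsLE (v : V) : ι ℂ v ∈ wordsLE b 1 := by
  induction b.mem_span v using Submodule.span_induction with
  | mem v h =>
    obtain ⟨x, rfl⟩ := h
    simpa using word_mem_wordsLE b (w := [x]) (n := 1) (by simp)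
  | zero => simp
  | add v w _ _ hv hw => rw [map_add]; exact Submodule.add_mem _ hv hw
  | smul c v _ hv => rw [map_smul]; exact Submodule.smul_mem _ c hv

theorem smul_word_mem (g : G) (w : List X) : g • word b w ∈ wordsLE b w.length := by
  induction w with
  | nil => rw [word_nil, smul_one]; exact word_mem_wordsLE b (w := []) le_rfl
  | cons x w ih =>
    rw [word_cons, smul_mul', tensorAction_ι, List.length_cons, add_comm]
    exact mul_mem_wordsLE b (ι_mem_wordsLE b _) ih

theorem smul_mem_wordsLE {n : ℕ} {t : TensorAlgebra ℂ V} (ht : t ∈ wordsLE b n) (g : G) :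
    g • t ∈ wordsLE b n := by
  induction ht using Submodule.span_induction with
  | mem t h =>
    obtain ⟨w, hw, rfl⟩ := h
    exact wordsLE_mono b hw (smul_word_mem b g w)
  | zero => simp
  | add v w _ _ hv hw => rw [smul_add]; exact Submodule.add_mem _ hv hw
  | smul c v _ hv => rw [smul_comm]; exact Submodule.smul_mem _ c hv

theorem exists_mem_wordsLE (t : TensorAlgebra ℂ V) : ∃ n, t ∈ wordsLE b n := by
  induction (span_words b).ge (Submodule.mem_top (x := t)) using Submodule.span_induction with
  | mem t h =>
    obtain ⟨w, rfl⟩ := h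
    exact ⟨_, word_mem_wordsLE b le_rfl⟩
  | zero => exact ⟨0, Submodule.zero_mem _⟩
  | add v w _ _ hv hw =>
    obtain ⟨m, hm⟩ := hv
    obtain ⟨n, hn⟩ := hw
    exact ⟨max m n, Submodule.add_mem _ (wordsLE_mono b (le_max_left _ _) hm)
      (wordsLE_mono b (le_max_right _ _) hn)⟩
  | smul c v _ hv =>
    obtain ⟨m, hm⟩ := hv
    exact ⟨m, Submodule.smul_mem _ c hm⟩

variable [Fintype G]

/-- `Φ (u [a, b] w) = ∑ₛ Kₛ(a, b) Φ' (u (s w))`. With `Φ' = Φ` this says that `Φ` factors through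
the quotient `A e` of `T(V)`; in general the right side has one order more in the bracket. -/
def IsBracketStep (Φ Φ' : TensorAlgebra ℂ V →ₗ[ℂ] N) : Prop :=
  ∀ (u w : TensorAlgebra ℂ V) (x y : V),
    Φ (u * (ι ℂ x * ι ℂ y - ι ℂ y * ι ℂ x) * w) = ∑ s : G, K s x y • Φ' (u * s • w)

variable {b K}

theorem isBracketStep_of_words {Φ Φ' : TensorAlgebra ℂ V →ₗ[ℂ] N}
    (H : ∀ u x y w, Φ (word b (u ++ x :: y :: w)) - Φ (word b (u ++ y :: x :: w))
      = ∑ s : G, K s (b x) (b y) • Φ' (word b u * s • word b w)) :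
    IsBracketStep K Φ Φ' := by
  intro u w v v'
  induction (span_words b).ge (Submodule.mem_top (x := u)) using Submodule.span_induction with
  | zero => simp
  | add u u' _ _ hu hu' => simp [add_mul, hu, hu', Finset.sum_add_distrib]
  | smul c u _ hu =>
    simp only [smul_mul_assoc, map_smul, hu, Finset.smul_sum]
    exact Finset.sum_congr rfl fun s _ => smul_comm _ _ _
  | mem u hu =>
  obtain ⟨u, rfl⟩ := hu
  induction (span_words b).ge (Submodule.mem_top (x := w)) using Submodule.span_induction with
  | zero => simp
  | add u u' _ _ hu hu' => simp [mul_add, hu, hu', Finset.sum_add_distrib]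
  | smul c u _ hu =>
    simp only [mul_smul_comm, map_smul, hu, Finset.smul_sum]
    exact Finset.sum_congr rfl fun s _ => by
      rw [smul_comm s c u, mul_smul_comm c, map_smul, smul_comm c]
  | mem w hw =>
  obtain ⟨w, rfl⟩ := hw
  induction b.mem_span v using Submodule.span_induction with
  | zero => simp
  | add v₁ v₂ _ _ h₁ h₂ =>
    simp only [map_add, add_mul, mul_add, LinearMap.add_apply, add_smul, Finset.sum_add_distrib,
      ← h₁, ← h₂, mul_sub, sub_mul, map_sub]
    abel
  | smul c v _ hv =>
    simp only [map_smul, LinearMap.smul_apply, smul_assoc, ← Finset.smul_sum, ← hv,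
      mul_sub, sub_mul, map_sub, smul_sub, smul_mul_assoc, mul_smul_comm]
  | mem v hv =>
  obtain ⟨x, rfl⟩ := hv
  induction b.mem_span v' using Submodule.span_induction with
  | zero => simp
  | add v₁ v₂ _ _ h₁ h₂ =>
    simp only [map_add, add_mul, mul_add, add_smul, Finset.sum_add_distrib,
      ← h₁, ← h₂, mul_sub, sub_mul, map_sub]
    abel
  | smul c v _ hv =>
    simp only [map_smul, smul_assoc, ← Finset.smul_sum, ← hv,
      mul_sub, sub_mul, map_sub, smul_sub, smul_mul_assoc, mul_smul_comm]
  | mem v hv =>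
  obtain ⟨y, rfl⟩ := hv
  rw [← H]
  simp [mul_sub, sub_mul, mul_assoc]

variable (b K)

/-- The correction `∑ₛ Kₛ(x, y) Φ (u (s w))` for exchanging the letters `x`, `y` of `u x y w`. -/
def exchangeCost (Φ : TensorAlgebra ℂ V →ₗ[ℂ] N) (u : List X) (x y : X) (w : List X) : N :=
  ∑ s : G, K s (b x) (b y) • Φ (word b u * s • word b w)

variable {b K}

/-- The condition `comm` comes from the equivariance of the bracket, and `braid` from the Jacobi
identity. -/
theorem IsBracketStep.isExchangeCocycle (hK : IsGroupBracket K)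
    {Φ Φ' : TensorAlgebra ℂ V →ₗ[ℂ] N} (h : IsBracketStep K Φ Φ') :
    IsExchangeCocycle (exchangeCost b K Φ) where
  self u x w := by simp [exchangeCost, (hK.alt _).self_eq_zero]
  anti u x y w := by
    rw [exchangeCost, exchangeCost, ← Finset.sum_neg_distrib]
    refine Finset.sum_congr rfl fun s _ => ?_
    rw [← neg_smul, (hK.alt s).neg_eq]
  comm u x y m p q w := by
    have key₁ : ∀ s : G, Φ (word b u * s • word b (m ++ p :: q :: w))
        - Φ (word b u * s • word b (m ++ q :: p :: w))
        = ∑ r : G, K r (s • b p) (s • b q) •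
            Φ' (word b u * (s • word b m) * (r * s) • word b w) := by
      intro s
      have := h (word b u * s • word b m) (s • word b w) (s • b p) (s • b q)
      simp only [← mul_smul] at this
      rw [← this]
      simp [mul_sub, sub_mul, mul_assoc, smul_mul', tensorAction_ι]
    have key₂ : ∀ r : G, Φ (word b (u ++ x :: y :: m) * r • word b w)
        - Φ (word b (u ++ y :: x :: m) * r • word b w)
        = ∑ s : G, K s (b x) (b y) • Φ' (word b u * (s • word b m) * (s * r) • word b w) := by
      intro r
      have := h (word b u) (word b m * r • word b w) (b x) (b y)
      simp only [smul_mul', ← mul_smul, ← mul_assoc] at this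
      rw [← this]
      simp [mul_sub, sub_mul, mul_assoc]
    simp only [exchangeCost, ← Finset.sum_sub_distrib, ← smul_sub, key₁, key₂, Finset.smul_sum]
    -- both sides are sums over pairs of group elements, matched by `(s, r) ↦ (s, s⁻¹ r s)`
    rw [Finset.sum_comm (s := Finset.univ (α := G))]
    conv_rhs => rw [Finset.sum_comm]
    conv_lhs => rw [Finset.sum_comm]
    refine Finset.sum_congr rfl fun s _ => ?_
    refine Fintype.sum_equiv ((MulAut.conj s⁻¹).toEquiv) _ _ fun r => ?_
    have e : (MulAut.conj s⁻¹).toEquiv r = s⁻¹ * r * s := by simp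
    have e' : s * (s⁻¹ * r * s) = r * s := by group
    rw [e, hK.conj, smul_comm, e']
  braid u x y z w := by
    have key : ∀ s : G, K s (b x) (b y) • (s • b z - b z)
        + K s (b x) (b z) • (b y - s • b y) + K s (b y) (b z) • (s • b x - b x) = 0 := by
      intro s
      rw [← hK.jacobi s (b x) (b y) (b z), ← (hK.alt s).neg_eq (b x) (b z)]
      simp only [smul_sub, neg_smul]
      abel
    have key' : ∀ s : G, Φ (word b u * ι ℂ (K s (b x) (b y) • (s • b z - b z)
        + K s (b x) (b z) • (b y - s • b y) + K s (b y) (b z) • (s • b x - b x))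
          * s • word b w) = 0 := by
      intro s
      simp [key]
    rw [← sub_eq_zero]
    simp only [exchangeCost, ← Finset.sum_add_distrib, ← Finset.sum_sub_distrib]
    refine Finset.sum_eq_zero fun s _ => ?_
    rw [← key' s]
    simp only [word_append, word_cons, word_nil, smul_mul', tensorAction_ι, map_add, map_smul,
      map_sub, mul_add, add_mul, mul_sub, sub_mul, smul_sub, mul_smul_comm, smul_mul_assoc, mul_one,
      mul_assoc]
    abel

end Straightening

/-! ### The Poincaré–Birkhoff–Witt normal form -/

section NormalForm

open TensorAlgebra MvPolynomial

variable {V : Type*} [AddCommGroup V] [Module ℂ V]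
  {G : Subgroup (LinearMap.GeneralLinearGroup ℂ V)} [Fintype G]
  {X : Type*} (b : Module.Basis X ℂ V)
  (K : G → LinearMap.BilinForm ℂ V)

/-- The commutative image `T(V) → S(V)`, with `S(V)` as the polynomials in a basis of `V`. -/
def commImage : TensorAlgebra ℂ V →ₐ[ℂ] MvPolynomial X ℂ :=
  TensorAlgebra.lift ℂ (b.constr ℂ MvPolynomial.X)

theorem commImage_ι_basis (x : X) : commImage b (ι ℂ (b x)) = MvPolynomial.X x := by
  simp [commImage]

theorem isBracketStep_commImage : IsBracketStep K (commImage b).toLinearMap 0 := by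
  intro u w x y
  simp [mul_comm]

/-- The polynomials of degree at most `n - 2 k`, where only `0` has negative degree. -/
def degreeDrop (X : Type*) (n k : ℕ) : Submodule ℂ (MvPolynomial X ℂ) :=
  if 2 * k ≤ n then restrictTotalDegree X ℂ (n - 2 * k) else ⊥

theorem mem_degreeDrop {n k : ℕ} {p : MvPolynomial X ℂ} :
    p ∈ degreeDrop X n k ↔ p = 0 ∨ p.totalDegree + 2 * k ≤ n := by
  unfold degreeDrop
  split_ifs with h
  · rw [mem_restrictTotalDegree]
    constructor
    · intro h'; right; omega
    · rintro (rfl | h')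
      · simp
      · omega
  · rw [Submodule.mem_bot]
    constructor
    · exact Or.inl
    · rintro (rfl | h')
      · rfl
      · omega

theorem degreeDrop_mono {m n k l : ℕ} (h : m + 2 * l ≤ n + 2 * k) :
    degreeDrop X m k ≤ degreeDrop X n l := by
  intro p hp
  rw [mem_degreeDrop] at hp ⊢
  exact hp.imp_right fun _ => by omega

theorem totalDegree_commImage_word (w : List X) :
    (commImage b (word b w)).totalDegree ≤ w.length := by
  induction w with
  | nil => simp
  | cons x w ih =>
    rw [word_cons, map_mul, commImage_ι_basis, List.length_cons]
    exact (totalDegree_mul _ _).trans (by rw [totalDegree_X]; omega)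

variable [LinearOrder X]

/-- The part of the normal form of order `k` in the bracket. -/
def normalFormPart : ℕ → TensorAlgebra ℂ V →ₗ[ℂ] MvPolynomial X ℂ
  | 0 => (commImage b).toLinearMap
  | k + 1 => onWords b (sortCost (exchangeCost b K (normalFormPart k)))

variable {K} in
theorem IsGroupBracket.isBracketStep_onWords (hK : IsGroupBracket K) {N : Type*} [AddCommGroup N]
    [Module ℂ N] {Φ Φ' : TensorAlgebra ℂ V →ₗ[ℂ] N} (h : IsBracketStep K Φ Φ') :
    IsBracketStep K (onWords b (sortCost (exchangeCost b K Φ))) Φ :=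
  isBracketStep_of_words fun u x y w => by
    rw [onWords_word, onWords_word, sortCost_exchange (h.isExchangeCocycle hK)]
    rfl

variable {K} in
theorem IsGroupBracket.isBracketStep_succ (hK : IsGroupBracket K) (k : ℕ) :
    IsBracketStep K (normalFormPart b K (k + 1)) (normalFormPart b K k) := by
  induction k with
  | zero => exact hK.isBracketStep_onWords b (isBracketStep_commImage b K)
  | succ k ih => exact hK.isBracketStep_onWords b ih

theorem normalFormPart_mem (k n : ℕ) {t : TensorAlgebra ℂ V} (ht : t ∈ wordsLE b n) :
    normalFormPart b K k t ∈ degreeDrop X n k := by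
  induction k generalizing n t with
  | zero =>
    induction ht using Submodule.span_induction with
    | mem t h =>
      obtain ⟨w, hw, rfl⟩ := h
      rw [mem_degreeDrop]
      exact Or.inr ((totalDegree_commImage_word b w).trans hw)
    | zero => simp
    | add v w _ _ hv hw => rw [map_add]; exact Submodule.add_mem _ hv hw
    | smul c v _ hv => rw [map_smul]; exact Submodule.smul_mem _ c hv
  | succ k ih =>
    induction ht using Submodule.span_induction with
    | mem t h =>
      obtain ⟨w, hw, rfl⟩ := h
      rw [normalFormPart, onWords_word]
      refine sortCost_mem _ _ fun u x y v h => Submodule.sum_mem _ fun s _ => ?_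
      refine Submodule.smul_mem _ _ (degreeDrop_mono (m := u.length + v.length) (by omega)
        (ih _ (mul_mem_wordsLE b (word_mem_wordsLE b le_rfl)
          (smul_mem_wordsLE b (word_mem_wordsLE b le_rfl) s))))
    | zero => simp
    | add v w _ _ hv hw => rw [map_add]; exact Submodule.add_mem _ hv hw
    | smul c v _ hv => rw [map_smul]; exact Submodule.smul_mem _ c hv

theorem normalFormPart_eq_zero {k n : ℕ} (h : n < k) {t : TensorAlgebra ℂ V}
    (ht : t ∈ wordsLE b n) : normalFormPart b K k t = 0 := by
  have := normalFormPart_mem b K k n ht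
  rw [mem_degreeDrop] at this
  exact this.resolve_right (by omega)

/-- The normal form `T(V) → S(V)`, where `S(V)` is identified with the span of the sorted words:
straightening of words by `[v, w] = ∑ₛ Kₛ(v, w) s`, with group elements moved to the right end
and dropped there. -/
def normalForm : TensorAlgebra ℂ V →ₗ[ℂ] MvPolynomial X ℂ :=
  onWords b fun w => ∑ k ∈ Finset.range (w.length + 1), normalFormPart b K k (word b w)

theorem normalForm_eq_sum {n : ℕ} {t : TensorAlgebra ℂ V} (ht : t ∈ wordsLE b n) :
    normalForm b K t = ∑ k ∈ Finset.range (n + 1), normalFormPart b K k t := by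
  induction ht using Submodule.span_induction with
  | mem t h =>
    obtain ⟨w, hw, rfl⟩ := h
    rw [normalForm, onWords_word]
    refine Finset.sum_subset (Finset.range_mono (by omega)) fun k _ hk => ?_
    rw [Finset.mem_range, not_lt] at hk
    exact normalFormPart_eq_zero b K (n := w.length) (by omega) (word_mem_wordsLE b le_rfl)
  | zero => simp
  | add v w _ _ hv hw => simp [hv, hw, Finset.sum_add_distrib]
  | smul c v _ hv => simp [hv, Finset.smul_sum]

variable {K} in
theorem IsGroupBracket.isBracketStep_normalForm (hK : IsGroupBracket K) :
    IsBracketStep K (normalForm b K) (normalForm b K) := by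
  intro u w x y
  obtain ⟨m, hm⟩ := exists_mem_wordsLE b u
  obtain ⟨n, hn⟩ := exists_mem_wordsLE b w
  have hx := ι_mem_wordsLE b x
  have hy := ι_mem_wordsLE b y
  have h1 := mul_mem_wordsLE b (mul_mem_wordsLE b hm (Submodule.sub_mem _
    (mul_mem_wordsLE b hx hy) (mul_mem_wordsLE b hy hx))) hn
  rw [normalForm_eq_sum b K (wordsLE_mono b (n := m + n + 2) (by omega) h1),
    Finset.sum_range_succ']
  have h2 : normalFormPart b K 0 (u * (ι ℂ x * ι ℂ y - ι ℂ y * ι ℂ x) * w) = 0 := by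
    exact (isBracketStep_commImage b K u w x y).trans (by simp)
  have h3 : ∀ s : G, normalForm b K (u * s • w)
      = ∑ k ∈ Finset.range (m + n + 2), normalFormPart b K k (u * s • w) := fun s =>
    normalForm_eq_sum b K (wordsLE_mono b (Nat.le_succ (m + n))
      (mul_mem_wordsLE b hm (smul_mem_wordsLE b hn s)))
  simp only [h2, add_zero, h3, Finset.smul_sum, hK.isBracketStep_succ b _ u w x y]
  exact Finset.sum_comm

theorem normalForm_sub_commImage_mem {n : ℕ} {t : TensorAlgebra ℂ V} (ht : t ∈ wordsLE b n) :
    normalForm b K t - commImage b t ∈ degreeDrop X n 1 := by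
  rw [normalForm_eq_sum b K ht, Finset.sum_range_succ']
  simp only [normalFormPart, AlgHom.toLinearMap_apply, add_sub_cancel_right]
  exact Submodule.sum_mem _ fun k _ => degreeDrop_mono (by omega)
    (normalFormPart_mem b K (k + 1) n ht)

theorem normalForm_sorted {w : List X} (hw : w.Pairwise (· ≤ ·)) :
    normalForm b K (word b w) = commImage b (word b w) := by
  rw [normalForm, onWords_word, Finset.sum_range_succ', Finset.sum_eq_zero, zero_add]
  · rfl
  · intro k _
    rw [normalFormPart, onWords_word, sortCost_eq_zero hw]

/-- The linear map `S(V) → T(V)` that writes each monomial as a sorted word. -/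
def sortedLift : MvPolynomial X ℂ →ₗ[ℂ] TensorAlgebra ℂ V :=
  (basisMonomials X ℂ).constr ℂ fun m => word b ((Finsupp.toMultiset m).sort (· ≤ ·))

theorem sortedLift_monomial (m : X →₀ ℕ) :
    sortedLift b (monomial m 1) = word b ((Finsupp.toMultiset m).sort (· ≤ ·)) := by
  have := (basisMonomials X ℂ).constr_basis ℂ
    (fun m => word b ((Finsupp.toMultiset m).sort (· ≤ ·))) m
  rwa [coe_basisMonomials] at this

theorem commImage_word (w : List X) :
    commImage b (word b w) = monomial (Multiset.toFinsupp (w : Multiset X)) 1 := by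
  induction w with
  | nil => simp
  | cons x w ih =>
    rw [word_cons, map_mul, commImage_ι_basis, ih, MvPolynomial.X, monomial_mul, one_mul,
      ← Multiset.cons_coe,
      ← Multiset.singleton_add, map_add, Multiset.toFinsupp_singleton]

theorem normalForm_sortedLift (p : MvPolynomial X ℂ) : normalForm b K (sortedLift b p) = p := by
  have : normalForm b K ∘ₗ sortedLift b = LinearMap.id := by
    refine (basisMonomials X ℂ).ext fun m => ?_
    rw [coe_basisMonomials, LinearMap.comp_apply, sortedLift_monomial,
      normalForm_sorted b K (Multiset.pairwise_sort _ _), commImage_word]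
    simp
  exact LinearMap.congr_fun this p

theorem sortedLift_mem {p : MvPolynomial X ℂ} {n : ℕ} (hp : p.totalDegree ≤ n) :
    sortedLift b p ∈ wordsLE b n := by
  rw [p.as_sum, map_sum]
  refine Submodule.sum_mem _ fun m hm => ?_
  have : (monomial m) (coeff m p) = coeff m p • monomial m (1 : ℂ) := by simp [smul_monomial]
  rw [this, map_smul, sortedLift_monomial]
  refine Submodule.smul_mem _ _ (word_mem_wordsLE b ?_)
  rw [Multiset.length_sort, Finsupp.card_toMultiset]
  exact (le_totalDegree hm).trans hp

variable {b K}

/-- A map that respects the straightening relations and kills the sorted words is zero. -/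
theorem IsBracketStep.eq_zero_of_sorted {N : Type*} [AddCommGroup N] [Module ℂ N]
    {ψ : TensorAlgebra ℂ V →ₗ[ℂ] N} (h : IsBracketStep K ψ ψ)
    (hs : ∀ w : List X, w.Pairwise (· ≤ ·) → ψ (word b w) = 0) : ψ = 0 := by
  have key : ∀ n, ∀ t ∈ wordsLE b n, ψ t = 0 := by
    intro n
    induction n using Nat.strong_induction_on with
    | _ n ih =>
    -- exchanges only change words by shorter ones
    have hperm : ∀ w w' : List X, w.Perm w' → ∀ u : List X, u.length + w.length ≤ n →
        ψ (word b (u ++ w)) = ψ (word b (u ++ w')) := by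
      intro w w' hw
      induction hw with
      | nil => simp
      | cons x _ ih' =>
        intro u hu
        have := ih' (u ++ [x]) (by simp at hu ⊢; omega)
        simpa using this
      | swap x y w =>
        intro u hu
        rw [← sub_eq_zero]
        have := h (word b u) (word b w) (b y) (b x)
        rw [Finset.sum_eq_zero fun s _ => ?_] at this
        · rw [← this]
          simp [mul_sub, sub_mul, mul_assoc]
        · rw [ih (u.length + w.length) (by simp at hu; omega) _ (mul_mem_wordsLE b
            (word_mem_wordsLE b le_rfl) (smul_mem_wordsLE b (word_mem_wordsLE b le_rfl) s)),
            smul_zero]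
      | trans h1 _ ih1 ih2 =>
        intro u hu
        rw [ih1 u hu, ih2 u (by rw [← h1.length_eq]; exact hu)]
    intro t ht
    induction ht using Submodule.span_induction with
    | mem t h =>
      obtain ⟨w, hw, rfl⟩ := h
      have := hperm w _ (List.perm_insertionSort (· ≤ ·) w).symm [] (by simpa using hw)
      rw [List.nil_append] at this
      rw [this]
      exact hs _ (List.pairwise_insertionSort _ _)
    | zero => simp
    | add v w _ _ hv hw => simp [hv, hw]
    | smul c v _ hv => simp [hv]
  exact LinearMap.ext fun t => by
    obtain ⟨n, hn⟩ := exists_mem_wordsLE b t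
    exact key n t hn

/-- Every map that respects the straightening relations factors through the normal form. -/
theorem IsBracketStep.apply_sortedLift_normalForm (hK : IsGroupBracket K) {N : Type*}
    [AddCommGroup N] [Module ℂ N] {ψ : TensorAlgebra ℂ V →ₗ[ℂ] N} (h : IsBracketStep K ψ ψ)
    (t : TensorAlgebra ℂ V) : ψ (sortedLift b (normalForm b K t)) = ψ t := by
  have h' : IsBracketStep K (ψ - ψ ∘ₗ sortedLift b ∘ₗ normalForm b K)
      (ψ - ψ ∘ₗ sortedLift b ∘ₗ normalForm b K) := by
    intro u w x y
    simp [h u w x y, hK.isBracketStep_normalForm b u w x y, smul_sub]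
  have := h'.eq_zero_of_sorted (b := b) fun w hw => by
    have hm : sortedLift b (commImage b (word b w)) = word b w := by
      rw [commImage_word, sortedLift_monomial, Multiset.toFinsupp_toMultiset]
      congr 1
      exact List.Perm.eq_of_pairwise (le := (· ≤ ·)) (fun a b _ _ h h' => le_antisymm h h')
        (Multiset.pairwise_sort _ _) hw (Multiset.coe_eq_coe.1 (Multiset.sort_eq _ _))
    simp [normalForm_sorted b K hw, hm]
  have := LinearMap.congr_fun this t
  rw [LinearMap.sub_apply, LinearMap.zero_apply, sub_eq_zero] at this
  exact this.symm

end NormalForm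

/-! ### The normal form on the left ideal `Ae` -/

section LeftIdealNormalForm

open TensorAlgebra MvPolynomial

variable {V : Type*} [AddCommGroup V] [Module ℂ V]
  {G : Subgroup (LinearMap.GeneralLinearGroup ℂ V)}

/-- The inclusion `T(V) → T(V) ∗ G`. -/
def tensorToSkew : TensorAlgebra ℂ V →ₐ[ℂ] SkewGroupAlgebra G where
  __ := SkewMonoidAlgebra.singleOneRingHom
  commutes' _ := rfl

theorem tensorToSkew_apply (t : TensorAlgebra ℂ V) :
    tensorToSkew (G := G) t = SkewMonoidAlgebra.single 1 t := rfl

theorem groupAlgebraToSkew_single (g : G) (c : ℂ) :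
    groupAlgebraToSkew G (MonoidAlgebra.single g c)
      = SkewMonoidAlgebra.single g (algebraMap ℂ (TensorAlgebra ℂ V) c) := by
  rw [groupAlgebraToSkew, MonoidAlgebra.lift_single, SkewMonoidAlgebra.of_apply,
    SkewMonoidAlgebra.smul_single, Algebra.algebraMap_eq_smul_one]

variable (κ : V → V → MonoidAlgebra ℂ G)

/-- The canonical map `T(V) → A`. -/
def tensorHom : TensorAlgebra ℂ V →ₐ[ℂ] HeckeAlgebra G κ :=
  (quotHom G κ).comp tensorToSkew

/-- The image in `A` of an element of `G`. -/
def groupElem (g : G) : HeckeAlgebra G κ := groupAlgebraHom G κ (MonoidAlgebra.single g 1)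

theorem quotHom_surjective : Function.Surjective (quotHom G κ) :=
  RingQuot.mkAlgHom_surjective ℂ _

theorem quotHom_single (g : G) (t : TensorAlgebra ℂ V) :
    quotHom G κ (SkewMonoidAlgebra.single g t) = tensorHom κ t * groupElem κ g := by
  simp [tensorHom, groupElem, groupAlgebraHom, tensorToSkew_apply, groupAlgebraToSkew_single,
    ← map_mul, SkewMonoidAlgebra.single_mul_single]

theorem groupElem_mul_tensorHom (g : G) (t : TensorAlgebra ℂ V) :
    groupElem κ g * tensorHom κ t = tensorHom κ (g • t) * groupElem κ g := by
  rw [← quotHom_single]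
  simp [tensorHom, groupElem, groupAlgebraHom, tensorToSkew_apply, groupAlgebraToSkew_single,
    ← map_mul, SkewMonoidAlgebra.single_mul_single]

theorem tensorHom_commutator (v w : V) :
    tensorHom κ (ι ℂ v * ι ℂ w - ι ℂ w * ι ℂ v) = groupAlgebraHom G κ (κ v w) := by
  rw [tensorHom, groupAlgebraHom, AlgHom.comp_apply, AlgHom.comp_apply, map_sub, map_mul, map_mul]
  exact RingQuot.mkAlgHom_rel ℂ (Rel.comm v w)

/-- The surjection `T(V) → Ae`, `t ↦ t e`. -/
def toLeftIdeal : TensorAlgebra ℂ V →ₗ[ℂ] LeftIdeal G κ where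
  toFun t := ⟨tensorHom κ t * idem G κ, Ideal.mem_span_singleton'.mpr ⟨_, rfl⟩⟩
  map_add' s t := Subtype.ext (by simp [add_mul])
  map_smul' c t := Subtype.ext (by simp)

theorem coe_toLeftIdeal (t : TensorAlgebra ℂ V) :
    (toLeftIdeal κ t : HeckeAlgebra G κ) = tensorHom κ t * idem G κ := rfl

variable [Fintype G]

theorem groupElem_mul_idem (g : G) : groupElem κ g * idem G κ = idem G κ := by
  rw [groupElem, idem, ← map_mul, symIdem, finsum_eq_sum_of_fintype, mul_smul_comm, Finset.mul_sum]
  congr 2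
  exact Fintype.sum_equiv (Equiv.mulLeft g) _ _ fun h => by
    simp [MonoidAlgebra.single_mul_single]

theorem idem_eq_sum : idem G κ = (Nat.card G : ℂ)⁻¹ • ∑ g : G, groupElem κ g := by
  simp [idem, symIdem, finsum_eq_sum_of_fintype, groupElem]

theorem exists_mul_idem_eq (a : HeckeAlgebra G κ) :
    ∃ t : TensorAlgebra ℂ V, a * idem G κ = tensorHom κ t * idem G κ := by
  obtain ⟨a, rfl⟩ := quotHom_surjective κ a
  induction a using SkewMonoidAlgebra.induction_on with
  | zero => exact ⟨0, by simp⟩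
  | single g t =>
    exact ⟨t, by rw [quotHom_single, mul_assoc, groupElem_mul_idem]⟩
  | add a a' h h' =>
    obtain ⟨t, ht⟩ := h
    obtain ⟨t', ht'⟩ := h'
    exact ⟨t + t', by rw [map_add, add_mul, ht, ht', map_add, add_mul]⟩

theorem toLeftIdeal_surjective : Function.Surjective (toLeftIdeal κ) := by
  intro m
  obtain ⟨a, ha⟩ := Ideal.mem_span_singleton'.mp m.2
  obtain ⟨t, ht⟩ := exists_mul_idem_eq κ a
  exact ⟨t, Subtype.ext (by rw [coe_toLeftIdeal, ← ht, ha])⟩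

theorem toLeftIdeal_smul (g : G) (t : TensorAlgebra ℂ V) :
    toLeftIdeal κ (g • t) = groupElem κ g • toLeftIdeal κ t := by
  apply Subtype.ext
  change _ = groupElem κ g * (tensorHom κ t * idem G κ)
  rw [← mul_assoc, groupElem_mul_tensorHom, mul_assoc, groupElem_mul_idem, coe_toLeftIdeal]

variable {K : G → LinearMap.BilinForm ℂ V}
  (hκ : ∀ v w, κ v w = ∑ s : G, MonoidAlgebra.single s (K s v w))

include hκ in
theorem isBracketStep_toLeftIdeal : IsBracketStep K (toLeftIdeal κ) (toLeftIdeal κ) := by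
  intro u w x y
  apply Subtype.ext
  have h : tensorHom κ (ι ℂ x * ι ℂ y - ι ℂ y * ι ℂ x) = ∑ s : G, K s x y • groupElem κ s := by
    rw [tensorHom_commutator, hκ, map_sum]
    refine Finset.sum_congr rfl fun s _ => ?_
    rw [groupElem, ← map_smul, MonoidAlgebra.smul_single, smul_eq_mul, mul_one]
  have h' : ((∑ s : G, K s x y • toLeftIdeal κ (u * s • w) : LeftIdeal G κ) : HeckeAlgebra G κ)
      = ∑ s : G, K s x y • (tensorHom κ (u * s • w) * idem G κ) := by
    rw [AddSubmonoidClass.coe_finsetSum]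
    rfl
  rw [h', coe_toLeftIdeal, map_mul, map_mul, h, Finset.mul_sum, Finset.sum_mul, Finset.sum_mul]
  refine Finset.sum_congr rfl fun s _ => ?_
  rw [mul_smul_comm, smul_mul_assoc, smul_mul_assoc, mul_assoc, mul_assoc,
    ← mul_assoc (groupElem _ _),
    groupElem_mul_tensorHom, mul_assoc _ (groupElem _ _), groupElem_mul_idem, map_mul, mul_assoc]

variable {X : Type*} [LinearOrder X] (b : Module.Basis X ℂ V)

variable (K) in
/-- The functional on `T(V) ∗ G` that takes the normal form and drops group elements standing on
the right. -/
def skewNormalForm : SkewGroupAlgebra G →ₗ[ℂ] MvPolynomial X ℂ :=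
  (Finsupp.lsum ℂ fun _ : G => normalForm b K) ∘ₗ
    (SkewMonoidAlgebra.coeffLinearEquiv (k := TensorAlgebra ℂ V) (S := ℂ) (G := G)).toLinearMap

theorem skewNormalForm_single (g : G) (t : TensorAlgebra ℂ V) :
    skewNormalForm K b (SkewMonoidAlgebra.single g t) = normalForm b K t := by
  rw [skewNormalForm, LinearMap.comp_apply]
  exact Finsupp.lsum_single _ _ _ _

variable {κ b}

include hκ in
theorem skewNormalForm_rel (hK : IsGroupBracket K) {p p' : SkewGroupAlgebra G} (h : Rel G κ p p')
    (q r : SkewGroupAlgebra G) :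
    skewNormalForm K b (q * p * r) = skewNormalForm K b (q * p' * r) := by
  induction q using SkewMonoidAlgebra.induction_on with
  | zero => simp
  | add a a' h h' => rw [add_mul, add_mul, map_add, h, h', add_mul, add_mul, map_add]
  | single g t =>
  induction r using SkewMonoidAlgebra.induction_on with
  | zero => simp
  | add a a' h h' => rw [mul_add, map_add, h, h', mul_add, map_add]
  | single k w =>
  obtain ⟨v, v'⟩ := h
  have h1 : SkewMonoidAlgebra.single g t * (vec G v * vec G v' - vec G v' * vec G v)
      * SkewMonoidAlgebra.single k w = SkewMonoidAlgebra.single (g * k)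
        (t * (ι ℂ (g • v) * ι ℂ (g • v') - ι ℂ (g • v') * ι ℂ (g • v)) * g • w) := by
    have : vec G v * vec G v' - vec G v' * vec G v
        = tensorToSkew (ι ℂ v * ι ℂ v' - ι ℂ v' * ι ℂ v) := by
      rw [map_sub, map_mul, map_mul]; rfl
    rw [this, tensorToSkew_apply, SkewMonoidAlgebra.single_mul_single,
      SkewMonoidAlgebra.single_mul_single, mul_one, smul_sub, smul_mul', smul_mul']
    simp only [tensorAction_ι]
  rw [h1, skewNormalForm_single, hK.isBracketStep_normalForm b, hκ, map_sum, Finset.mul_sum,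
    Finset.sum_mul, map_sum]
  symm
  -- moving `g` to the right replaces `s` by `g s g⁻¹`
  refine Fintype.sum_equiv (MulAut.conj g).toEquiv _ _ fun s => ?_
  have e : (MulAut.conj g).toEquiv s = g * s * g⁻¹ := by simp
  have e' : g⁻¹ * (g * s * g⁻¹) * g = s := by group
  rw [groupAlgebraToSkew_single, SkewMonoidAlgebra.single_mul_single,
    SkewMonoidAlgebra.single_mul_single, skewNormalForm_single, e, ← hK.conj, e', ← mul_smul]
  have e'' : g * s * g⁻¹ * g = g * s := by group
  rw [e'']
  have e3 : g • algebraMap ℂ (TensorAlgebra ℂ V) (K s v v') = algebraMap ℂ _ (K s v v') := by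
    rw [Algebra.algebraMap_eq_smul_one, smul_comm, smul_one]
  rw [e3, ← Algebra.commutes, mul_assoc, ← Algebra.smul_def, map_smul]

include hκ in
theorem skewNormalForm_eq_of_quotHom_eq (hK : IsGroupBracket K) {p p' : SkewGroupAlgebra G}
    (h : quotHom G κ p = quotHom G κ p') : skewNormalForm K b p = skewNormalForm K b p' := by
  have h1 : RingQuot.mkRingHom (Rel G κ) p = RingQuot.mkRingHom (Rel G κ) p' := by
    rw [← RingQuot.mkAlgHom_coe ℂ]; exact h
  rw [RingQuot.mkRingHom_def] at h1
  have h2 : Relation.EqvGen (RingQuot.Rel (Rel G κ)) p p' :=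
    Quot.eqvGen_exact (congrArg RingQuot.toQuot h1)
  have h3 : ∀ {x y}, RingQuot.Rel (Rel G κ) x y → ∀ q r : SkewGroupAlgebra G,
      skewNormalForm K b (q * x * r) = skewNormalForm K b (q * y * r) := by
    intro x y hxy
    induction hxy with
    | of h => exact skewNormalForm_rel hκ hK h
    | add_left _ ih => intro q r; simp only [mul_add, add_mul, map_add, ih q r]
    | mul_left _ ih => intro q r; simpa only [mul_assoc] using ih q (_ * r)
    | mul_right _ ih => intro q r; simpa only [mul_assoc] using ih (q * _) r
  clear h h1
  induction h2 with
  | rel _ _ h => simpa using h3 h 1 1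
  | refl => rfl
  | symm _ _ _ ih => exact ih.symm
  | trans _ _ _ _ _ ih ih' => exact ih.trans ih'

include hκ in
theorem normalForm_eq_zero (hK : IsGroupBracket K) {t : TensorAlgebra ℂ V}
    (h : toLeftIdeal κ t = 0) : normalForm b K t = 0 := by
  have hcard : (Fintype.card G : ℂ) ≠ 0 := Nat.cast_ne_zero.mpr Fintype.card_ne_zero
  have h1 : tensorHom κ t * idem G κ
      = quotHom G κ ((Nat.card G : ℂ)⁻¹ • ∑ g : G, SkewMonoidAlgebra.single g t) := by
    simp only [idem_eq_sum, mul_smul_comm, Finset.mul_sum, map_smul, map_sum, quotHom_single]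
  have h2 := skewNormalForm_eq_of_quotHom_eq (b := b) hκ hK (p' := 0)
    (h1.symm.trans ((congrArg Subtype.val h).trans (map_zero _).symm))
  rw [map_zero, map_smul, map_sum] at h2
  simp only [skewNormalForm_single, Finset.sum_const, Finset.card_univ, Nat.card_eq_fintype_card,
    ← Nat.cast_smul_eq_nsmul ℂ, smul_smul, inv_mul_cancel₀ hcard, one_smul] at h2
  exact h2

variable (b)

include hκ in
/-- The Poincaré–Birkhoff–Witt theorem for `Ae`: it has the sorted monomials as a basis. -/
theorem bijective_toLeftIdeal_sortedLift (hK : IsGroupBracket K) :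
    Function.Bijective (toLeftIdeal κ ∘ₗ sortedLift b) := by
  constructor
  · rw [injective_iff_map_eq_zero]
    intro p hp
    rw [← normalForm_sortedLift b K p, normalForm_eq_zero hκ hK hp]
  · intro m
    obtain ⟨t, rfl⟩ := toLeftIdeal_surjective κ m
    exact ⟨normalForm b K t, (isBracketStep_toLeftIdeal κ hκ).apply_sortedLift_normalForm hK t⟩

/-- The linear isomorphism `Ae ≃ S(V)` that takes the normal form. -/
def leftIdealEquiv (hK : IsGroupBracket K) : LeftIdeal G κ ≃ₗ[ℂ] MvPolynomial X ℂ :=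
  (LinearEquiv.ofBijective _ (bijective_toLeftIdeal_sortedLift hκ b hK)).symm

theorem leftIdealEquiv_toLeftIdeal (hK : IsGroupBracket K) (t : TensorAlgebra ℂ V) :
    leftIdealEquiv hκ b hK (toLeftIdeal κ t) = normalForm b K t := by
  rw [leftIdealEquiv, LinearEquiv.symm_apply_eq, LinearEquiv.ofBijective_apply,
    LinearMap.comp_apply, (isBracketStep_toLeftIdeal κ hκ).apply_sortedLift_normalForm hK]

theorem leftIdealEquiv_symm_apply (hK : IsGroupBracket K) (p : MvPolynomial X ℂ) :
    (leftIdealEquiv hκ b hK).symm p = toLeftIdeal κ (sortedLift b p) := rfl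

end LeftIdealNormalForm

/-! ### Linear group actions on polynomials -/

section Invariants

open MvPolynomial

variable {Γ : Type*} [Group Γ] {X : Type*}

theorem homogeneousComponent_mul_of_isHomogeneous {p q : MvPolynomial X ℂ} {k : ℕ}
    (hq : q.IsHomogeneous k) (n : ℕ) :
    homogeneousComponent n (p * q) = if k ≤ n then homogeneousComponent (n - k) p * q else 0 := by
  have h : ∀ i, homogeneousComponent n (homogeneousComponent i p * q)
      = if i + k = n then homogeneousComponent i p * q else 0 := fun i => by
    rw [homogeneousComponent_of_mem ((homogeneousComponent_isHomogeneous i p).mul hq)]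
    simp only [eq_comm]
  conv_lhs => rw [← sum_homogeneousComponent p, Finset.sum_mul, map_sum]
  simp only [h]
  split_ifs with hk
  · by_cases hp : n - k ∈ Finset.range (p.totalDegree + 1)
    · rw [Finset.sum_eq_single_of_mem _ hp fun i _ hi => if_neg (by omega), if_pos (by omega)]
    · rw [homogeneousComponent_eq_zero _ _ (by rw [Finset.mem_range] at hp; omega), zero_mul]
      refine Finset.sum_eq_zero fun i hi => if_neg ?_
      rintro rfl
      exact hp (by simpa using hi)
  · exact Finset.sum_eq_zero fun i _ => if_neg (by omega)

/-- A group acting on polynomials by linear substitutions of the variables. -/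
def IsLinearAction (ρ : Γ →* (MvPolynomial X ℂ →ₐ[ℂ] MvPolynomial X ℂ)) : Prop :=
  ∀ g x, (ρ g (MvPolynomial.X x)).IsHomogeneous 1

variable {ρ : Γ →* (MvPolynomial X ℂ →ₐ[ℂ] MvPolynomial X ℂ)}

theorem IsLinearAction.isHomogeneous (hρ : IsLinearAction ρ) (g : Γ) {p : MvPolynomial X ℂ}
    {n : ℕ} (hp : p.IsHomogeneous n) : (ρ g p).IsHomogeneous n := by
  have h := hp.aeval (ρ g ∘ MvPolynomial.X) (fun x => hρ g x)
  rw [← aeval_unique (ρ g), one_mul] at h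
  exact h

theorem IsLinearAction.homogeneousComponent_apply (hρ : IsLinearAction ρ) (g : Γ)
    (p : MvPolynomial X ℂ) (n : ℕ) :
    homogeneousComponent n (ρ g p) = ρ g (homogeneousComponent n p) := by
  conv_lhs => rw [← sum_homogeneousComponent p, map_sum, map_sum]
  have h : ∀ i, homogeneousComponent n (ρ g (homogeneousComponent i p))
      = if n = i then ρ g (homogeneousComponent i p) else 0 := fun i =>
    homogeneousComponent_of_mem
      (hρ.isHomogeneous g (homogeneousComponent_isHomogeneous i p))
  simp only [h, Finset.sum_ite_eq, Finset.mem_range]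
  split_ifs with hn
  · rfl
  · rw [homogeneousComponent_eq_zero _ _ (by omega), map_zero]

variable (ρ) in
/-- The algebra of invariant polynomials. -/
def invariants : Subalgebra ℂ (MvPolynomial X ℂ) where
  carrier := {p | ∀ g, ρ g p = p}
  mul_mem' ha hb g := by rw [map_mul, ha g, hb g]
  add_mem' ha hb g := by rw [map_add, ha g, hb g]
  algebraMap_mem' r g := by simp

theorem IsLinearAction.homogeneousComponent_mem (hρ : IsLinearAction ρ) {p : MvPolynomial X ℂ}
    (hp : p ∈ invariants ρ) (n : ℕ) : homogeneousComponent n p ∈ invariants ρ := fun g => by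
  rw [← hρ.homogeneousComponent_apply, hp g]

/-- In a relation between homogeneous polynomials with invariant coefficients, the coefficients
may be taken homogeneous of complementary degree. -/
theorem IsLinearAction.exists_homogeneous_coeff (hρ : IsLinearAction ρ) {ι : Type*} [Fintype ι]
    {f : ι → MvPolynomial X ℂ} {e : ι → ℕ} (hf : ∀ i, (f i).IsHomogeneous (e i))
    {c : ι → MvPolynomial X ℂ} (hc : ∀ i, c i ∈ invariants ρ) {n : ℕ}
    (h : (∑ i, c i * f i).IsHomogeneous n) :
    ∃ c' : ι → MvPolynomial X ℂ, (∀ i, c' i ∈ invariants ρ) ∧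
      (∀ i, c' i = 0 ∨ ∃ k, k + e i = n ∧ (c' i).IsHomogeneous k) ∧
      ∑ i, c i * f i = ∑ i, c' i * f i := by
  refine ⟨fun i => if e i ≤ n then homogeneousComponent (n - e i) (c i) else 0, fun i => ?_,
    fun i => ?_, ?_⟩
  · dsimp only
    split_ifs
    · exact hρ.homogeneousComponent_mem (hc i) _
    · exact zero_mem _
  · dsimp only
    split_ifs with hi
    · exact Or.inr ⟨n - e i, by omega, homogeneousComponent_isHomogeneous _ _⟩
    · exact Or.inl rfl
  · conv_lhs => rw [← homogeneousComponent_eq_self h, map_sum]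
    refine Finset.sum_congr rfl fun i _ => ?_
    rw [homogeneousComponent_mul_of_isHomogeneous (hf i), ite_mul, zero_mul]

section Finiteness

variable [Finite Γ]

variable (ρ) in
theorem isIntegral_invariants : Algebra.IsIntegral (invariants ρ) (MvPolynomial X ℂ) := by
  let : MulSemiringAction Γ (MvPolynomial X ℂ) :=
    { smul := fun g p => ρ g p
      one_smul := fun p => by change ρ 1 p = p; simp
      mul_smul := fun g h p => by change ρ (g * h) p = ρ g (ρ h p); simp
      smul_zero := fun g => map_zero (ρ g)
      smul_add := fun g => map_add (ρ g)
      smul_one := fun g => map_one (ρ g)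
      smul_mul := fun g => map_mul (ρ g) }
  have : Algebra.IsInvariant (invariants ρ) (MvPolynomial X ℂ) Γ :=
    ⟨fun p hp => ⟨⟨p, hp⟩, rfl⟩⟩
  exact Algebra.IsInvariant.isIntegral (invariants ρ) (MvPolynomial X ℂ) Γ

variable [Finite X]

variable (ρ) in
theorem finite_invariants : Module.Finite (invariants ρ) (MvPolynomial X ℂ) := by
  have := isIntegral_invariants ρ
  have : Algebra.FiniteType (invariants ρ) (MvPolynomial X ℂ) :=
    Algebra.FiniteType.of_restrictScalars_finiteType ℂ _ _
  exact Algebra.IsIntegral.finite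

variable (ρ) in
/-- Noether's theorem: the algebra of invariants is finitely generated. -/
theorem fg_invariants : (invariants ρ).FG := by
  have := finite_invariants ρ
  rw [← Subalgebra.fg_top]
  exact fg_of_fg_of_fg ℂ (invariants ρ) (MvPolynomial X ℂ) Algebra.FiniteType.out
    Module.Finite.fg_top Subtype.val_injective

/-- The polynomials are generated over the invariants by finitely many homogeneous ones. -/
theorem IsLinearAction.exists_homogeneous_generators (hρ : IsLinearAction ρ) :
    ∃ (r : ℕ) (f : Fin r → MvPolynomial X ℂ) (e : Fin r → ℕ), (∀ i, (f i).IsHomogeneous (e i)) ∧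
      ∀ (n : ℕ) (p : MvPolynomial X ℂ), p.IsHomogeneous n →
        ∃ c : Fin r → MvPolynomial X ℂ, (∀ i, c i ∈ invariants ρ) ∧
          (∀ i, c i = 0 ∨ ∃ k, k + e i = n ∧ (c i).IsHomogeneous k) ∧
          p = ∑ i, c i * f i := by
  obtain ⟨s, hs⟩ := (finite_invariants ρ).fg_top
  let N := s.sup totalDegree
  let φ := (Fintype.equivFin (s × Fin (N + 1))).symm
  have hf : ∀ i, (homogeneousComponent (φ i).2 ((φ i).1 : MvPolynomial X ℂ)).IsHomogeneous
    ((φ i).2 : ℕ) := fun i => homogeneousComponent_isHomogeneous _ _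
  refine ⟨_, fun i => homogeneousComponent (φ i).2 ((φ i).1 : MvPolynomial X ℂ),
    fun i => ((φ i).2 : ℕ), hf, fun n p hp => ?_⟩
  have hmem : p ∈ Submodule.span (invariants ρ) (s : Set (MvPolynomial X ℂ)) := by
    rw [hs]; trivial
  rw [Submodule.mem_span_finset'] at hmem
  obtain ⟨a, rfl⟩ := hmem
  have key : ∑ q : s, a q • (q : MvPolynomial X ℂ)
      = ∑ i, (a (φ i).1 : MvPolynomial X ℂ)
        * homogeneousComponent (φ i).2 ((φ i).1 : MvPolynomial X ℂ) := by
    rw [Fintype.sum_equiv φ _ (fun j => (a j.1 : MvPolynomial X ℂ)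
      * homogeneousComponent j.2 (j.1 : MvPolynomial X ℂ)) (fun _ => rfl), Fintype.sum_prod_type]
    refine Finset.sum_congr rfl fun q _ => ?_
    dsimp only
    rw [← Finset.mul_sum, Finset.sum_fin_eq_sum_range, Subalgebra.smul_def, smul_eq_mul]
    congr 1
    conv_lhs => rw [← sum_homogeneousComponent (q : MvPolynomial X ℂ)]
    have hq : (q : MvPolynomial X ℂ).totalDegree ≤ N := Finset.le_sup q.2
    rw [Finset.sum_subset (Finset.range_mono (Nat.succ_le_succ hq)) fun k _ hk =>
      homogeneousComponent_eq_zero _ _ (by simpa using hk)]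
    exact Finset.sum_congr rfl fun k hk => by rw [dif_pos (Finset.mem_range.mp hk)]
  rw [key] at hp ⊢
  exact hρ.exists_homogeneous_coeff hf (fun i => (a (φ i).1).2) hp

end Finiteness

end Invariants

/-! ### Matrix units of the group algebra and a homogeneous frame of `S(V)` -/

section Frame

open MvPolynomial

variable {Γ : Type*} [Group Γ]
  {n : ℕ} {d : Fin n → ℕ}
  (w : MonoidAlgebra ℂ Γ ≃ₐ[ℂ] Π i, Matrix (Fin (d i)) (Fin (d i)) ℂ)

/-- The matrix units of the group algebra with respect to a Wedderburn decomposition. -/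
def matrixUnit (i : Fin n) (a c : Fin (d i)) : MonoidAlgebra ℂ Γ :=
  w.symm (Pi.single i (Matrix.single a c 1))

theorem matrixUnit_mul_same (i : Fin n) (a c c' : Fin (d i)) :
    matrixUnit w i a c * matrixUnit w i c c' = matrixUnit w i a c' := by
  rw [matrixUnit, matrixUnit, ← map_mul, ← Pi.single_mul, Matrix.single_mul_single_same, one_mul]
  rfl

theorem matrixUnit_mul_of_ne (i : Fin n) (a c b c' : Fin (d i)) (h : c ≠ b) :
    matrixUnit w i a c * matrixUnit w i b c' = 0 := by
  rw [matrixUnit, matrixUnit, ← map_mul, ← Pi.single_mul, Matrix.single_mul_single_of_ne _ _ _ _ h,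
    Pi.single_zero, map_zero]

theorem matrixUnit_mul_of_ne_index {i j : Fin n} (h : i ≠ j) (a c : Fin (d i)) (b c' : Fin (d j)) :
    matrixUnit w i a c * matrixUnit w j b c' = 0 := by
  rw [matrixUnit, matrixUnit, ← map_mul]
  refine (congrArg w.symm ?_).trans (map_zero w.symm)
  ext k : 1
  rw [Pi.mul_apply, Pi.zero_apply]
  rcases eq_or_ne k i with rfl | hk
  · rw [Pi.single_eq_of_ne h, mul_zero]
  · rw [Pi.single_eq_of_ne hk, zero_mul]

/-- The index set of the matrix units. -/
abbrev UnitIndex (d : Fin n → ℕ) : Type := Σ i, Fin (d i) × Fin (d i)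

/-- The matrix units form a basis of the group algebra. -/
def matrixUnitBasis : Module.Basis (UnitIndex d) ℂ (MonoidAlgebra ℂ Γ) :=
  (Pi.basis fun i => Matrix.stdBasis ℂ (Fin (d i)) (Fin (d i))).map w.symm.toLinearEquiv

theorem matrixUnitBasis_apply (j : UnitIndex d) :
    matrixUnitBasis w j = matrixUnit w j.1 j.2.1 j.2.2 := by
  obtain ⟨i, a, c⟩ := j
  simp [matrixUnitBasis, matrixUnit, Matrix.stdBasis_eq_single]

include w in
theorem card_unitIndex [Fintype Γ] : Fintype.card (UnitIndex d) = Fintype.card Γ := by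
  rw [← Module.finrank_eq_card_basis (matrixUnitBasis w),
    (MonoidAlgebra.coeffLinearEquiv ℂ).finrank_eq, Module.finrank_finsupp_self]

variable {X : Type*} (ρ : Γ →* (MvPolynomial X ℂ →ₐ[ℂ] MvPolynomial X ℂ))

/-- The action of the group algebra on polynomials. -/
def polyAction : MonoidAlgebra ℂ Γ →ₐ[ℂ] Module.End ℂ (MvPolynomial X ℂ) :=
  MonoidAlgebra.lift ℂ _ Γ
    { toFun := fun g => (ρ g).toLinearMap
      map_one' := by ext; simp
      map_mul' := fun g h => by ext; simp }

theorem polyAction_single (g : Γ) (c : ℂ) (p : MvPolynomial X ℂ) :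
    polyAction ρ (MonoidAlgebra.single g c) p = c • ρ g p := by
  simp [polyAction, MonoidAlgebra.lift_single]

variable {ρ} in
theorem IsLinearAction.isHomogeneous_polyAction (hρ : IsLinearAction ρ) (a : MonoidAlgebra ℂ Γ)
    {p : MvPolynomial X ℂ} {n : ℕ} (hp : p.IsHomogeneous n) :
    (polyAction ρ a p).IsHomogeneous n := by
  induction a using MonoidAlgebra.induction_linear with
  | zero => simpa using isHomogeneous_zero X ℂ n
  | add a a' h h' => rw [map_add]; exact h.add h'
  | single g c =>
    rw [polyAction_single, smul_eq_C_mul]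
    exact (hρ.isHomogeneous g hp).C_mul c

variable [Fintype Γ]

/-- The values of a polynomial on the orbit of a point `ξ`, as an element of the group algebra. -/
def orbitEval (ξ : X → ℂ) : MvPolynomial X ℂ →ₗ[ℂ] MonoidAlgebra ℂ Γ :=
  ∑ g : Γ, MonoidAlgebra.lsingle g⁻¹ ∘ₗ (aeval ξ).toLinearMap ∘ₗ (ρ g).toLinearMap

theorem orbitEval_apply (ξ : X → ℂ) (p : MvPolynomial X ℂ) :
    orbitEval ρ ξ p = ∑ g : Γ, MonoidAlgebra.single g⁻¹ (aeval ξ (ρ g p)) := by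
  simp [orbitEval]

theorem orbitEval_polyAction (ξ : X → ℂ) (a : MonoidAlgebra ℂ Γ) (p : MvPolynomial X ℂ) :
    orbitEval ρ ξ (polyAction ρ a p) = a * orbitEval ρ ξ p := by
  induction a using MonoidAlgebra.induction_linear with
  | zero => simp
  | add a a' h h' => rw [map_add, LinearMap.add_apply, map_add, h, h', add_mul]
  | single h c =>
    rw [polyAction_single, map_smul, orbitEval_apply, orbitEval_apply, Finset.mul_sum,
      Finset.smul_sum]
    refine Fintype.sum_equiv (Equiv.mulRight h) _ _ fun g => ?_
    simp [MonoidAlgebra.single_mul_single]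

theorem orbitEval_surjective {ξ : X → ℂ}
    (hξ : Function.Injective fun (g : Γ) (x : X) => aeval (R := ℂ) ξ (ρ g (MvPolynomial.X x))) :
    Function.Surjective (orbitEval ρ ξ) := by
  classical
  -- a polynomial that is `1` at `g ξ` and vanishes on the rest of the orbit
  have h1 : ∀ g h : Γ, ∃ p : MvPolynomial X ℂ,
      aeval ξ (ρ g p) = 1 ∧ (h ≠ g → aeval ξ (ρ h p) = 0) := by
    intro g h
    by_cases hgh : h = g
    · exact ⟨1, by simp, fun h' => absurd hgh h'⟩
    · obtain ⟨x, hx⟩ := Function.ne_iff.mp (hξ.ne hgh)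
      have hx' := sub_ne_zero.mpr (Ne.symm hx)
      refine ⟨C ((aeval ξ (ρ g (MvPolynomial.X x)) - aeval ξ (ρ h (MvPolynomial.X x)))⁻¹)
        * (MvPolynomial.X x - C (aeval ξ (ρ h (MvPolynomial.X x)))), ?_, fun _ => ?_⟩
      · simp only [map_mul, map_sub, ← algebraMap_eq, AlgHom.commutes]
        exact inv_mul_cancel₀ hx'
      · simp only [map_mul, map_sub, ← algebraMap_eq, AlgHom.commutes]
        simp
  choose p hp using h1
  have h2 : ∀ g h : Γ, aeval ξ (ρ h (∏ k, p g k)) = if h = g then 1 else 0 := by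
    intro g h
    rw [map_prod, map_prod]
    split_ifs with hgh
    · subst hgh
      exact Finset.prod_eq_one fun k _ => (hp h k).1
    · exact Finset.prod_eq_zero (Finset.mem_univ h) ((hp g h).2 hgh)
  intro a
  induction a using MonoidAlgebra.induction_linear with
  | zero => exact ⟨0, map_zero _⟩
  | add a a' h h' =>
    obtain ⟨f, rfl⟩ := h
    obtain ⟨f', rfl⟩ := h'
    exact ⟨f + f', map_add _ _ _⟩
  | single g c =>
    refine ⟨c • ∏ k, p g⁻¹ k, ?_⟩
    rw [map_smul, orbitEval_apply]
    simp only [h2]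
    rw [Finset.sum_eq_single g⁻¹]
    · simp
    · intro h _ hh
      simp [hh]
    · simp

variable {ρ}

/-- Homogeneous polynomials `v j`, as many as `Γ` has elements, that are linearly independent on
some orbit form a basis of the polynomials over the invariants up to a discriminant `D`, the square
of the determinant of the matrix of conjugates of the `v j`. -/
theorem IsLinearAction.exists_discriminant (hρ : IsLinearAction ρ) (ξ : X → ℂ) {J : Type*}
    [Fintype J] (hJ : Fintype.card J = Fintype.card Γ) {v : J → MvPolynomial X ℂ} {δ : J → ℕ}
    (hv : ∀ j, (v j).IsHomogeneous (δ j))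
    (hind : LinearIndependent ℂ fun j => orbitEval ρ ξ (v j)) :
    (∃ (D : MvPolynomial X ℂ) (N : ℕ), D ≠ 0 ∧ D ∈ invariants ρ ∧ D.IsHomogeneous N ∧
      ∀ (n : ℕ) (f : MvPolynomial X ℂ), f.IsHomogeneous n →
        ∃ l : J → MvPolynomial X ℂ, (∀ j, l j ∈ invariants ρ) ∧
          (∀ j, l j = 0 ∨ ∃ k, k + δ j = n + N ∧ (l j).IsHomogeneous k) ∧
          f * D = ∑ j, l j * v j) ∧
    ∀ l : J → MvPolynomial X ℂ, (∀ j, l j ∈ invariants ρ) → ∑ j, l j * v j = 0 → l = 0 := by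
  classical
  let σ : Γ ≃ J := Fintype.equivOfCardEq hJ.symm
  let M : Matrix Γ Γ (MvPolynomial X ℂ) := Matrix.of fun g h => ρ g (v (σ h))
  have hdet : M.det ≠ 0 := by
    intro h0
    have h1 : (M.map (aeval (R := ℂ) ξ)).det = 0 := by
      have := AlgHom.map_det (aeval (R := ℂ) ξ) M
      rw [h0, map_zero] at this
      exact this.symm
    obtain ⟨c, hc0, hc⟩ := Matrix.exists_mulVec_eq_zero_iff.mpr h1
    apply hc0
    have h2 : ∑ j, c (σ.symm j) • orbitEval ρ ξ (v j) = 0 := by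
      simp only [← map_smul, ← map_sum]
      rw [orbitEval_apply]
      refine Finset.sum_eq_zero fun g _ => ?_
      have h3 := congrFun hc g
      rw [Matrix.mulVec, dotProduct] at h3
      have h4 : aeval ξ (ρ g (∑ j, c (σ.symm j) • v j)) = 0 := by
        rw [← h3.trans (Pi.zero_apply _), map_sum, map_sum]
        refine (Fintype.sum_equiv σ _ _ fun h => ?_).symm
        simp [M, mul_comm]
      rw [h4, MonoidAlgebra.single_zero]
    funext h
    simpa using Fintype.linearIndependent_iff.mp hind _ h2 (σ h)
  -- `Γ` permutes the rows of `M`, so it multiplies determinants of this kind by a sign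
  have hsign : ∀ (k : Γ) (M' : Matrix Γ Γ (MvPolynomial X ℂ)),
      (∀ g h, ρ k (M' g h) = M' (k * g) h) →
      ρ k M'.det = Equiv.Perm.sign (Equiv.mulLeft k) * M'.det := by
    intro k M' hM'
    rw [AlgHom.map_det, ← Matrix.det_permute]
    congr 1
    ext1 g h
    exact hM' g h
  have hM : ∀ k g h, ρ k (M g h) = M (k * g) h := fun k g h => by
    simp [M]
  have hsq : ∀ k : Γ, ((Equiv.Perm.sign (Equiv.mulLeft k) : ℤ) : MvPolynomial X ℂ)
      * ((Equiv.Perm.sign (Equiv.mulLeft k) : ℤ) : MvPolynomial X ℂ) = 1 := fun k => by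
    rw [← Int.cast_mul, ← Units.val_mul, Int.units_mul_self]
    simp
  have hhom : M.det.IsHomogeneous (∑ h, δ (σ h)) := by
    rw [Matrix.det_apply]
    refine IsHomogeneous.sum _ _ _ fun τ _ => ?_
    have : (∏ i, M (τ i) i).IsHomogeneous (∑ h, δ (σ h)) :=
      IsHomogeneous.prod _ _ _ fun i _ => hρ.isHomogeneous _ (hv _)
    exact (homogeneousSubmodule X ℂ _).toAddSubgroup.zsmul_mem this _
  refine ⟨⟨M.det * M.det, _, mul_ne_zero hdet hdet, fun k => ?_, hhom.mul hhom, fun n f hf => ?_⟩,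
    fun l hl h0 => ?_⟩
  · rw [map_mul, hsign k M (hM k), mul_mul_mul_comm, hsq, one_mul]
  · -- Cramer's rule for the coefficients of `f`
    let φ : Γ → MvPolynomial X ℂ := fun g => ρ g f
    have hcr : ∀ k h, ρ k (M.cramer φ h)
        = Equiv.Perm.sign (Equiv.mulLeft k) * M.cramer φ h := by
      intro k h
      rw [Matrix.cramer_apply]
      refine hsign k _ fun g h' => ?_
      rw [Matrix.updateCol_apply, Matrix.updateCol_apply]
      split_ifs
      · simp [φ]
      · exact hM k g h'
    have h1 : f * (M.det * M.det) = ∑ j, (M.det * M.cramer φ (σ.symm j)) * v j := by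
      have := congrFun (M.mulVec_cramer φ) 1
      rw [Matrix.mulVec, dotProduct, Pi.smul_apply, smul_eq_mul] at this
      have h2 : f = φ 1 := by simp [φ]
      rw [mul_left_comm, mul_comm f, h2, ← this, Finset.mul_sum]
      refine Fintype.sum_equiv σ _ _ fun h => ?_
      simp [M]
      ring
    have h2 : ∀ j, M.det * M.cramer φ (σ.symm j) ∈ invariants ρ := fun j k => by
      rw [map_mul, hsign k M (hM k), hcr, mul_mul_mul_comm, hsq, one_mul]
    have h3 := hf.mul (hhom.mul hhom)
    rw [h1] at h3 ⊢
    exact hρ.exists_homogeneous_coeff hv h2 h3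
  · have h1 : M.mulVec (fun h => l (σ h)) = 0 := by
      funext g
      rw [Matrix.mulVec, dotProduct, Pi.zero_apply, ← map_zero (ρ g), ← h0, map_sum]
      refine Fintype.sum_equiv σ _ _ fun h => ?_
      rw [map_mul, hl, mul_comm]
      rfl
    have h2 := Matrix.eq_zero_of_mulVec_eq_zero hdet h1
    funext j
    simpa using congrFun h2 (σ.symm j)

variable [∀ i, NeZero (d i)]

/-- The polynomials `E^i_{a0} q^i_c`, for matrix units `E^i_{ab}` and polynomials `q^i_c` fixed by
`E^i_{00}`: they are permuted by the matrix units like the matrix units `E^i_{ac}` themselves. -/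
def frameElem (q : ∀ i, Fin (d i) → MvPolynomial X ℂ) (j : UnitIndex d) : MvPolynomial X ℂ :=
  polyAction ρ (matrixUnit w j.1 j.2.1 0) (q j.1 j.2.2)

/-- There are homogeneous polynomials in the range of `E^i_{00}` whose values on a free orbit form a
basis of the right ideal `E^i_{00} ℂΓ`. -/
theorem exists_homogeneous_seeds {ξ : X → ℂ}
    (hξ : Function.Injective fun (g : Γ) (x : X) => aeval (R := ℂ) ξ (ρ g (MvPolynomial.X x)))
    (hρ : IsLinearAction ρ) (i : Fin n) :
    ∃ (q : Fin (d i) → MvPolynomial X ℂ) (δ : Fin (d i) → ℕ),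
      (∀ c, (q c).IsHomogeneous (δ c)) ∧
      (∀ c, polyAction ρ (matrixUnit w i 0 0) (q c) = q c) ∧
      LinearIndependent ℂ fun c => orbitEval ρ ξ (q c) := by
  let H : Set (MvPolynomial X ℂ) :=
    {p | (∃ k, p.IsHomogeneous k) ∧ polyAction ρ (matrixUnit w i 0 0) p = p}
  have hH : ∀ c, matrixUnit w i 0 c ∈ Submodule.span ℂ (orbitEval ρ ξ '' H) := by
    intro c
    obtain ⟨f, hf⟩ := orbitEval_surjective ρ hξ (matrixUnit w i 0 c)
    rw [← matrixUnit_mul_same w i 0 0 c, ← hf, ← orbitEval_polyAction,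
      ← sum_homogeneousComponent f, map_sum, map_sum]
    refine Submodule.sum_mem _ fun k _ => Submodule.subset_span ⟨_, ⟨⟨k, ?_⟩, ?_⟩, rfl⟩
    · exact hρ.isHomogeneous_polyAction _ (homogeneousComponent_isHomogeneous _ _)
    · rw [← Module.End.mul_apply, ← map_mul, matrixUnit_mul_same]
  obtain ⟨s, hsH, hspan, hli⟩ := exists_linearIndependent ℂ (orbitEval ρ ξ '' H)
  rw [← hspan] at hH
  have : Module.Finite ℂ (MonoidAlgebra ℂ Γ) := (matrixUnitBasis w).finiteDimensional_of_finite
  have : Fintype s := hli.setFinite.fintype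
  have hli' : LinearIndependent ℂ fun c => matrixUnit w i 0 c := by
    have := (matrixUnitBasis w).linearIndependent.comp
      (fun c : Fin (d i) => (⟨i, 0, c⟩ : UnitIndex d)) (fun c c' h => by simpa using h)
    convert this using 2 with c
    simp [matrixUnitBasis_apply]
  have hcard : Fintype.card (Fin (d i)) ≤ Fintype.card s :=
    linearIndependent_le_span_aux' _ hli' s (by rintro _ ⟨c, rfl⟩; exact hH c)
  obtain ⟨φ⟩ := Function.Embedding.nonempty_of_card_le hcard
  choose q hqH hq using fun x : s => hsH x.2
  refine ⟨fun c => q (φ c), fun c => (hqH (φ c)).1.choose, fun c => (hqH (φ c)).1.choose_spec,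
    fun c => (hqH (φ c)).2, ?_⟩
  simp only [hq]
  exact hli.comp φ φ.injective

theorem linearIndependent_orbitEval_frameElem {ξ : X → ℂ}
    {q : ∀ i, Fin (d i) → MvPolynomial X ℂ}
    (hq : ∀ i c, polyAction ρ (matrixUnit w i 0 0) (q i c) = q i c)
    (hli : ∀ i, LinearIndependent ℂ fun c => orbitEval ρ ξ (q i c)) :
    LinearIndependent ℂ fun j => orbitEval ρ ξ (frameElem (ρ := ρ) w q j) := by
  rw [Fintype.linearIndependent_iff]
  rintro l hl ⟨i, a, c⟩
  have h1 := congrArg (matrixUnit w i 0 a * ·) hl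
  simp only [mul_zero, Finset.mul_sum, mul_smul_comm, frameElem, orbitEval_polyAction] at h1
  rw [Fintype.sum_sigma, Finset.sum_eq_single_of_mem i (Finset.mem_univ i), Fintype.sum_prod_type,
    Finset.sum_eq_single_of_mem a (Finset.mem_univ a)] at h1
  · have h2 : ∀ c, matrixUnit w i 0 a * (matrixUnit w i a 0 * orbitEval ρ ξ (q i c))
        = orbitEval ρ ξ (q i c) := fun c => by
      rw [← mul_assoc, matrixUnit_mul_same, ← orbitEval_polyAction, hq]
    simp only [h2] at h1
    exact Fintype.linearIndependent_iff.mp (hli i) _ h1 c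
  · intro a' _ ha'
    refine Finset.sum_eq_zero fun c _ => ?_
    rw [← mul_assoc, matrixUnit_mul_of_ne w i 0 a a' 0 ha'.symm, zero_mul, smul_zero]
  · intro j _ hj
    refine Finset.sum_eq_zero fun c _ => ?_
    rw [← mul_assoc, matrixUnit_mul_of_ne_index w hj.symm, zero_mul, smul_zero]

end Frame

/-! ### Filtered deformations of the action on polynomials -/

section Degree

open MvPolynomial

variable {X : Type*}

variable (X) in
/-- The polynomials of degree less than `n`. -/
def degreeLT (n : ℕ) : Submodule ℂ (MvPolynomial X ℂ) :=
  ⨅ k ≥ n, LinearMap.ker (homogeneousComponent k)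

theorem mem_degreeLT {n : ℕ} {p : MvPolynomial X ℂ} :
    p ∈ degreeLT X n ↔ ∀ k ≥ n, homogeneousComponent k p = 0 := by
  simp [degreeLT]

theorem eq_zero_of_forall_homogeneousComponent {p : MvPolynomial X ℂ}
    (h : ∀ k, homogeneousComponent k p = 0) : p = 0 := by
  rw [← sum_homogeneousComponent p]
  exact Finset.sum_eq_zero fun k _ => h k

theorem degreeLT_zero : degreeLT X 0 = ⊥ :=
  (Submodule.eq_bot_iff _).mpr fun _ hp =>
    eq_zero_of_forall_homogeneousComponent fun k => mem_degreeLT.mp hp k (Nat.zero_le _)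

theorem degreeLT_mono {m n : ℕ} (h : m ≤ n) : degreeLT X m ≤ degreeLT X n := fun _ hp =>
  mem_degreeLT.mpr fun k hk => mem_degreeLT.mp hp k (h.trans hk)

theorem mem_degreeLT_of_totalDegree_lt {p : MvPolynomial X ℂ} {n : ℕ} (h : p.totalDegree < n) :
    p ∈ degreeLT X n :=
  mem_degreeLT.mpr fun _ hk => homogeneousComponent_eq_zero _ _ (h.trans_le hk)

theorem mem_degreeLT_iff_totalDegree {n : ℕ} {p : MvPolynomial X ℂ} :
    p ∈ degreeLT X (n + 1) ↔ p.totalDegree ≤ n := by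
  refine ⟨fun h => ?_, fun h => mem_degreeLT_of_totalDegree_lt (by omega)⟩
  rw [← sum_homogeneousComponent p]
  refine totalDegree_finsetSum_le fun k _ => ?_
  rcases le_or_gt k n with hk | hk
  · exact (homogeneousComponent_isHomogeneous k p).totalDegree_le.trans hk
  · rw [mem_degreeLT.mp h k hk]; simp

theorem exists_mem_degreeLT (p : MvPolynomial X ℂ) : ∃ n, p ∈ degreeLT X n :=
  ⟨_, mem_degreeLT_of_totalDegree_lt (Nat.lt_succ_self _)⟩

theorem mem_degreeLT_of_isHomogeneous {p : MvPolynomial X ℂ} {n : ℕ} (h : p.IsHomogeneous n) :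
    p ∈ degreeLT X (n + 1) :=
  mem_degreeLT_iff_totalDegree.mpr h.totalDegree_le

theorem mem_degreeLT_of_succ {p : MvPolynomial X ℂ} {n : ℕ} (h : p ∈ degreeLT X (n + 1))
    (h0 : homogeneousComponent n p = 0) : p ∈ degreeLT X n :=
  mem_degreeLT.mpr fun k hk => by
    rcases hk.eq_or_lt with rfl | hk
    · exact h0
    · exact mem_degreeLT.mp h k hk

theorem sub_homogeneousComponent_mem {p : MvPolynomial X ℂ} {n : ℕ} (h : p ∈ degreeLT X (n + 1)) :
    p - homogeneousComponent n p ∈ degreeLT X n := by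
  have h1 := mem_degreeLT_of_isHomogeneous (homogeneousComponent_isHomogeneous n p)
  refine mem_degreeLT_of_succ (Submodule.sub_mem _ h h1) ?_
  rw [map_sub, homogeneousComponent_eq_self (homogeneousComponent_isHomogeneous n p), sub_self]

theorem mul_mem_degreeLT {p q : MvPolynomial X ℂ} {m n : ℕ} (hp : p ∈ degreeLT X (m + 1))
    (hq : q ∈ degreeLT X (n + 1)) : p * q ∈ degreeLT X (m + n + 1) := by
  rw [mem_degreeLT_iff_totalDegree] at *
  exact (totalDegree_mul _ _).trans (add_le_add hp hq)

theorem mul_mem_degreeLT_left {p q : MvPolynomial X ℂ} {m n : ℕ} (hp : p ∈ degreeLT X m)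
    (hq : q ∈ degreeLT X (n + 1)) : p * q ∈ degreeLT X (m + n) := by
  cases m with
  | zero =>
    rw [degreeLT_zero, Submodule.mem_bot] at hp
    rw [hp, zero_mul]
    exact Submodule.zero_mem _
  | succ m => rw [Nat.add_right_comm]; exact mul_mem_degreeLT hp hq

theorem homogeneousComponent_mul_top {p q : MvPolynomial X ℂ} {m n : ℕ}
    (hp : p ∈ degreeLT X (m + 1)) (hq : q ∈ degreeLT X (n + 1)) :
    homogeneousComponent (m + n) (p * q)
      = homogeneousComponent m p * homogeneousComponent n q := by
  have h1 : p * q = p * homogeneousComponent n q + (q - homogeneousComponent n q) * p := by ring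
  have h2 := mul_mem_degreeLT_left (sub_homogeneousComponent_mem hq) hp
  rw [h1, map_add, mem_degreeLT.mp h2 _ (by omega), add_zero,
    homogeneousComponent_mul_of_isHomogeneous (homogeneousComponent_isHomogeneous n q),
    if_pos (by omega), Nat.add_sub_cancel]

end Degree

section Deformation

set_option linter.unusedSectionVars false

open MvPolynomial

variable {Γ : Type*} [Group Γ] {X : Type*}
  {A : Type*} [Ring A] [Algebra ℂ A]
  {B : Type*} [CommRing B] [Algebra ℂ B]
  {M : Type*} [AddCommGroup M] [Module ℂ M] [Module A M] [Module B M]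
  [IsScalarTower ℂ A M] [IsScalarTower ℂ B M] [SMulCommClass A B M]

variable (B) in
/-- A filtered deformation of the polynomials `S` with its action of `Γ` and of the invariants:
a module `M` with commuting actions of an algebra `A` to which `ℂΓ` maps and of a commutative
algebra `B`, together with a linear identification `Ψ : M ≃ S` such that `B` is the space of
`Γ`-invariants of `M` (by `b ↦ b ε`) and both actions are the standard ones on leading terms. -/
structure IsDeformation (ρ : Γ →* (MvPolynomial X ℂ →ₐ[ℂ] MvPolynomial X ℂ))
    (γ : MonoidAlgebra ℂ Γ →ₐ[ℂ] A) (ε : M) (Ψ : M ≃ₗ[ℂ] MvPolynomial X ℂ) : Prop where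
  map_unit : Ψ ε = 1
  smul_unit_injective : ∀ b : B, b • ε = 0 → b = 0
  fixed : ∀ (b : B) (g : Γ), γ (MonoidAlgebra.single g 1) • b • ε = b • ε
  exists_smul_unit : ∀ m : M, (∀ g : Γ, γ (MonoidAlgebra.single g 1) • m = m) → ∃ b : B, b • ε = m
  smul_sub_mem : ∀ {n k : ℕ} {m : M} {b : B}, Ψ m ∈ degreeLT X (n + 1) →
    Ψ (b • ε) ∈ degreeLT X (k + 1) → Ψ (b • m) - Ψ m * Ψ (b • ε) ∈ degreeLT X (n + k)
  act_sub_mem : ∀ {n : ℕ} {m : M} (g : Γ), Ψ m ∈ degreeLT X (n + 1) →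
    Ψ (γ (MonoidAlgebra.single g 1) • m) - ρ g (Ψ m) ∈ degreeLT X n

namespace IsDeformation

variable {ρ : Γ →* (MvPolynomial X ℂ →ₐ[ℂ] MvPolynomial X ℂ)} {γ : MonoidAlgebra ℂ Γ →ₐ[ℂ] A}
  {ε : M} {Ψ : M ≃ₗ[ℂ] MvPolynomial X ℂ}

section Basic

variable (h : IsDeformation B ρ γ ε Ψ)
include h

theorem smul_mem {n k : ℕ} {m : M} {b : B} (hm : Ψ m ∈ degreeLT X (n + 1))
    (hb : Ψ (b • ε) ∈ degreeLT X (k + 1)) : Ψ (b • m) ∈ degreeLT X (n + k + 1) := by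
  rw [← sub_add_cancel (Ψ (b • m)) (Ψ m * Ψ (b • ε))]
  exact Submodule.add_mem _ (degreeLT_mono (Nat.le_succ _) (h.smul_sub_mem hm hb))
    (mul_mem_degreeLT hm hb)

theorem smul_mem_left {n k : ℕ} {m : M} {b : B} (hm : Ψ m ∈ degreeLT X n)
    (hb : Ψ (b • ε) ∈ degreeLT X (k + 1)) : Ψ (b • m) ∈ degreeLT X (n + k) := by
  cases n with
  | zero =>
    rw [degreeLT_zero, Submodule.mem_bot, LinearEquiv.map_eq_zero_iff] at hm
    rw [hm, smul_zero, map_zero]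
    exact Submodule.zero_mem _
  | succ n => rw [Nat.add_right_comm]; exact h.smul_mem hm hb

theorem component_smul {n k : ℕ} {m : M} {b : B} (hm : Ψ m ∈ degreeLT X (n + 1))
    (hb : Ψ (b • ε) ∈ degreeLT X (k + 1)) :
    homogeneousComponent (n + k) (Ψ (b • m))
      = homogeneousComponent n (Ψ m) * homogeneousComponent k (Ψ (b • ε)) := by
  rw [← homogeneousComponent_mul_top hm hb, ← sub_eq_zero, ← map_sub]
  exact mem_degreeLT.mp (h.smul_sub_mem hm hb) _ le_rfl

theorem act_mem (hρ : IsLinearAction ρ) {n : ℕ} {m : M} (hm : Ψ m ∈ degreeLT X (n + 1))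
    (a : MonoidAlgebra ℂ Γ) :
    Ψ (γ a • m) ∈ degreeLT X (n + 1) ∧
      homogeneousComponent n (Ψ (γ a • m)) = polyAction ρ a (homogeneousComponent n (Ψ m)) := by
  induction a using MonoidAlgebra.induction_linear with
  | zero => simp
  | add a a' ih ih' =>
    rw [map_add, add_smul, map_add, map_add, ih.2, ih'.2, map_add]
    exact ⟨Submodule.add_mem _ ih.1 ih'.1, rfl⟩
  | single g c =>
    have h1 : γ (MonoidAlgebra.single g c) • m = c • γ (MonoidAlgebra.single g 1) • m := by
      rw [← smul_assoc, ← map_smul, MonoidAlgebra.smul_single, smul_eq_mul, mul_one]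
    have h2 := h.act_sub_mem g hm
    rw [h1, LinearEquiv.map_smul Ψ c, map_smul (homogeneousComponent n) c, polyAction_single,
      ← hρ.homogeneousComponent_apply]
    refine ⟨Submodule.smul_mem _ _ ?_, ?_⟩
    · rw [← sub_add_cancel (Ψ _) (ρ g (Ψ m))]
      refine Submodule.add_mem _ (degreeLT_mono (Nat.le_succ _) h2)
        (mem_degreeLT.mpr fun k hk => ?_)
      rw [hρ.homogeneousComponent_apply, mem_degreeLT.mp hm k hk, map_zero]
    · rw [← sub_eq_zero, ← smul_sub, ← map_sub, mem_degreeLT.mp h2 _ le_rfl, smul_zero]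

theorem component_mem_invariants (hρ : IsLinearAction ρ) {b : B} {n : ℕ}
    (hb : Ψ (b • ε) ∈ degreeLT X (n + 1)) :
    homogeneousComponent n (Ψ (b • ε)) ∈ invariants ρ := fun g => by
  have := (h.act_mem hρ hb (MonoidAlgebra.single g 1)).2
  rw [h.fixed, polyAction_single, one_smul] at this
  exact this.symm

/-- Every homogeneous invariant is the leading term of an element of `B`. -/
theorem exists_lift [Fintype Γ] (hρ : IsLinearAction ρ) {p : MvPolynomial X ℂ}
    (hp : p ∈ invariants ρ) {n : ℕ} (hn : p.IsHomogeneous n) :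
    ∃ b : B, Ψ (b • ε) ∈ degreeLT X (n + 1) ∧ homogeneousComponent n (Ψ (b • ε)) = p := by
  have hcard : (Fintype.card Γ : ℂ) ≠ 0 := Nat.cast_ne_zero.mpr Fintype.card_ne_zero
  let a : MonoidAlgebra ℂ Γ := (Fintype.card Γ : ℂ)⁻¹ • ∑ g : Γ, MonoidAlgebra.single g 1
  have ha : ∀ g, MonoidAlgebra.single g 1 * a = a := fun g => by
    simp only [a, mul_smul_comm, Finset.mul_sum, MonoidAlgebra.single_mul_single, mul_one]
    congr 1
    exact Fintype.sum_equiv (Equiv.mulLeft g) _ _ fun _ => rfl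
  have hap : polyAction ρ a p = p := by
    simp only [a, map_smul, map_sum, LinearMap.smul_apply, LinearMap.sum_apply, polyAction_single,
      one_smul, hp _, Finset.sum_const, Finset.card_univ, ← Nat.cast_smul_eq_nsmul ℂ, smul_smul,
      inv_mul_cancel₀ hcard]
  have hm : Ψ (Ψ.symm p) ∈ degreeLT X (n + 1) := by
    rw [LinearEquiv.apply_symm_apply]
    exact mem_degreeLT_of_isHomogeneous hn
  obtain ⟨b, hb⟩ := h.exists_smul_unit (γ a • Ψ.symm p) fun g => by
    rw [← mul_smul, ← map_mul, ha]
  have h1 := h.act_mem hρ hm a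
  rw [LinearEquiv.apply_symm_apply, homogeneousComponent_eq_self hn, hap, ← hb] at h1
  exact ⟨b, h1⟩

theorem nontrivial : Nontrivial B := by
  refine ⟨1, 0, fun h1 => ?_⟩
  have h2 : ε = 0 := by rw [← one_smul B ε, h1, zero_smul]
  have := h.map_unit
  rw [h2, map_zero] at this
  exact zero_ne_one this

theorem exists_leading {b : B} (hb : b ≠ 0) :
    ∃ k, Ψ (b • ε) ∈ degreeLT X (k + 1) ∧ homogeneousComponent k (Ψ (b • ε)) ≠ 0 := by
  classical
  by_contra! hk
  have h1 : ∀ n, Ψ (b • ε) ∉ degreeLT X n := by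
    intro n
    induction n with
    | zero =>
      rw [degreeLT_zero, Submodule.mem_bot, LinearEquiv.map_eq_zero_iff]
      exact fun h0 => hb (h.smul_unit_injective b h0)
    | succ n ih => exact fun hn => ih (mem_degreeLT_of_succ hn (hk n hn))
  obtain ⟨n, hn⟩ := exists_mem_degreeLT (Ψ (b • ε))
  exact h1 n hn

theorem isDomain : IsDomain B := by
  have := h.nontrivial
  have : NoZeroDivisors B := ⟨fun {a b} hab => by
    by_contra! hne
    obtain ⟨k, hk, hk0⟩ := h.exists_leading hne.1
    obtain ⟨l, hl, hl0⟩ := h.exists_leading hne.2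
    have := h.component_smul hl hk
    rw [← mul_smul, hab, zero_smul, map_zero, map_zero] at this
    exact mul_ne_zero hl0 hk0 this.symm⟩
  exact NoZeroDivisors.to_isDomain B

theorem eq_algebraMap_of_mem {b : B} (hb : Ψ (b • ε) ∈ degreeLT X 1) :
    ∃ c : ℂ, b = algebraMap ℂ B c := by
  have h1 := totalDegree_eq_zero_iff_eq_C.mp
    (Nat.le_zero.mp (mem_degreeLT_iff_totalDegree.mp hb))
  refine ⟨coeff 0 (Ψ (b • ε)), sub_eq_zero.mp (h.smul_unit_injective _ ?_)⟩
  rw [sub_smul, algebraMap_smul, sub_eq_zero]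
  apply Ψ.injective
  rw [LinearEquiv.map_smul, h.map_unit, smul_eq_C_mul, mul_one]
  exact h1

/-- A nonzero element of `B` lies outside some maximal ideal: the units of `B` have degree zero. -/
theorem exists_maximal_notMem {f : B} (hf : f ≠ 0) : ∃ m : MaximalSpectrum B, f ∉ m.asIdeal := by
  have := h.nontrivial
  by_contra! hm
  have hj : f ∈ Ideal.jacobson (⊥ : Ideal B) :=
    Ideal.mem_sInf.mpr fun {I} hI => hm ⟨I, hI.2⟩
  have hu : IsUnit (f + 1) := by simpa using Ideal.mem_jacobson_bot.mp hj 1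
  obtain ⟨v, hv⟩ := hu.exists_right_inv
  have hv0 : v ≠ 0 := by rintro rfl; simp at hv
  have h1 : f + 1 ≠ 0 := by intro h0; rw [h0, zero_mul] at hv; exact zero_ne_one hv
  obtain ⟨k, hk, hk0⟩ := h.exists_leading h1
  obtain ⟨l, hl, hl0⟩ := h.exists_leading hv0
  have h2 := h.component_smul hl hk
  rw [← mul_smul, hv, one_smul, h.map_unit] at h2
  have h3 : l + k = 0 := by
    by_contra h0
    rw [homogeneousComponent_eq_zero _ _ (by simpa using Nat.pos_of_ne_zero h0)] at h2
    exact mul_ne_zero hl0 hk0 h2.symm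
  obtain rfl : k = 0 := by omega
  obtain ⟨c, hc⟩ := h.eq_algebraMap_of_mem hk
  obtain ⟨m, hmax⟩ := Ideal.exists_maximal B
  have h4 : f = algebraMap ℂ B (c - 1) := by rw [map_sub, ← hc, map_one, add_sub_cancel_right]
  have h5 : c - 1 ≠ 0 := fun h0 => hf (by rw [h4, h0, map_zero])
  exact hmax.ne_top (Ideal.eq_top_of_isUnit_mem _ (h4 ▸ hm ⟨m, hmax⟩)
    ((IsUnit.mk0 _ h5).map (algebraMap ℂ B)))

/-- The algebra `B` is generated by lifts of the components of generators of the invariants. -/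
theorem finiteType [Fintype Γ] [Finite X] (hρ : IsLinearAction ρ) : Algebra.FiniteType ℂ B := by
  classical
  obtain ⟨t, ht⟩ := fg_invariants ρ
  have hinv : ∀ p ∈ t, p ∈ invariants ρ := fun p hp => ht ▸ Algebra.subset_adjoin hp
  choose lift hlift using fun (p : t) (k : ℕ) =>
    h.exists_lift hρ (hρ.homogeneousComponent_mem (hinv p p.2) k)
      (homogeneousComponent_isHomogeneous k p.1)
  -- the components of the generators, lifted to `B`
  let s : Finset B := t.attach.biUnion fun p =>
    (Finset.range (p.1.totalDegree + 1)).image (lift p)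
  have hs : ∀ p ∈ Algebra.adjoin ℂ (t : Set (MvPolynomial X ℂ)), ∀ n,
      ∃ b ∈ Algebra.adjoin ℂ (s : Set B), Ψ (b • ε) ∈ degreeLT X (n + 1) ∧
        homogeneousComponent n (Ψ (b • ε)) = homogeneousComponent n p := by
    intro p hp
    induction hp using Algebra.adjoin_induction with
    | mem p hp =>
      intro n
      rcases le_or_gt n p.totalDegree with hn | hn
      · refine ⟨lift ⟨p, hp⟩ n, Algebra.subset_adjoin ?_, hlift ⟨p, hp⟩ n⟩
        simp only [s, Finset.coe_biUnion, Set.mem_iUnion, Finset.mem_coe, Finset.mem_image,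
          Finset.mem_range]
        exact ⟨⟨p, hp⟩, Finset.mem_attach _ _, n, by simpa using Nat.lt_succ_of_le hn, rfl⟩
      · exact ⟨0, zero_mem _, by simp, by simp [homogeneousComponent_eq_zero _ _ hn]⟩
    | algebraMap r =>
      intro n
      refine ⟨algebraMap ℂ B r, Subalgebra.algebraMap_mem _ r, ?_, ?_⟩ <;>
        rw [algebraMap_smul, map_smul, h.map_unit, ← Algebra.algebraMap_eq_smul_one]
      exact degreeLT_mono (Nat.succ_le_succ (Nat.zero_le n))
        (mem_degreeLT_of_isHomogeneous (isHomogeneous_C X r))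
    | add p q _ _ hp hq =>
      intro n
      obtain ⟨a, ha, ha1, ha2⟩ := hp n
      obtain ⟨b, hb, hb1, hb2⟩ := hq n
      refine ⟨a + b, add_mem ha hb, ?_, ?_⟩ <;> rw [add_smul, map_add]
      · exact Submodule.add_mem _ ha1 hb1
      · rw [map_add, ha2, hb2, map_add]
    | mul p q _ _ hp hq =>
      intro n
      choose a ha ha1 ha2 using hp
      choose b hb hb1 hb2 using hq
      let r := (Finset.range (q.totalDegree + 1)).filter (· ≤ n)
      have hr : ∀ k ∈ r, n - k + k = n := fun k hk => by
        simp only [r, Finset.mem_filter] at hk; omega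
      refine ⟨∑ k ∈ r, b k * a (n - k), sum_mem fun k _ => mul_mem (hb k) (ha _), ?_, ?_⟩
      · rw [Finset.sum_smul, map_sum]
        refine Submodule.sum_mem _ fun k hk => ?_
        rw [mul_smul]
        have := h.smul_mem (ha1 (n - k)) (hb1 k)
        rwa [hr k hk] at this
      · rw [Finset.sum_smul, map_sum, map_sum]
        conv_rhs => rw [← sum_homogeneousComponent q, Finset.mul_sum, map_sum]
        rw [Finset.sum_filter]
        refine Finset.sum_congr rfl fun k hk => ?_
        rw [homogeneousComponent_mul_of_isHomogeneous (homogeneousComponent_isHomogeneous k q)]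
        split_ifs with hkn
        · have := h.component_smul (ha1 (n - k)) (hb1 k)
          rw [Nat.sub_add_cancel hkn, ha2, hb2] at this
          rw [mul_smul, this]
        · rfl
  refine ⟨s, eq_top_iff.mpr fun b _ => ?_⟩
  have key : ∀ n, ∀ b : B, Ψ (b • ε) ∈ degreeLT X n → b ∈ Algebra.adjoin ℂ (s : Set B) := by
    intro n
    induction n with
    | zero =>
      intro b hb
      rw [degreeLT_zero, Submodule.mem_bot, LinearEquiv.map_eq_zero_iff] at hb
      rw [h.smul_unit_injective b hb]
      exact zero_mem _
    | succ n ih =>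
      intro b hb
      obtain ⟨b', hb', h1, h2⟩ := hs _ (ht ▸ h.component_mem_invariants hρ hb) n
      rw [homogeneousComponent_eq_self (homogeneousComponent_isHomogeneous _ _)] at h2
      have h3 := ih (b - b') (by
        rw [sub_smul, map_sub]
        refine mem_degreeLT_of_succ (Submodule.sub_mem _ hb h1) ?_
        rw [map_sub, h2, sub_self])
      simpa using add_mem h3 hb'
  obtain ⟨n, hn⟩ := exists_mem_degreeLT (Ψ (b • ε))
  exact key n b hn

/-- The residue fields of `B` are `ℂ`. -/
theorem exists_sub_algebraMap_mem [Fintype Γ] [Finite X] (hρ : IsLinearAction ρ) (m : Ideal B)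
    [m.IsMaximal] (b : B) : ∃ c : ℂ, b - algebraMap ℂ B c ∈ m := by
  have := h.finiteType hρ
  let : Field (B ⧸ m) := Ideal.Quotient.field m
  have : Algebra.FiniteType ℂ (B ⧸ m) :=
    Algebra.FiniteType.of_surjective (Ideal.Quotient.mkₐ ℂ m) (Ideal.Quotient.mkₐ_surjective ℂ m)
  have : Module.Finite ℂ (B ⧸ m) := finite_of_finite_type_of_isJacobsonRing ℂ (B ⧸ m)
  obtain ⟨c, hc⟩ := (IsAlgClosed.algebraMap_bijective_of_isIntegral (k := ℂ)
    (K := B ⧸ m)).2 (Ideal.Quotient.mk m b)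
  refine ⟨c, Ideal.Quotient.eq.mp ?_⟩
  rw [← hc]
  rfl

end Basic

end IsDeformation

end Deformation

/-! ### Generic freeness -/

section GenericFreeness

set_option linter.unusedSectionVars false

open MvPolynomial

variable {Γ : Type*} [Group Γ] [Fintype Γ] {X : Type*}
  {A : Type*} [Ring A] [Algebra ℂ A]
  {B : Type*} [CommRing B] [Algebra ℂ B]
  {M : Type*} [AddCommGroup M] [Module ℂ M] [Module A M] [Module B M]
  [IsScalarTower ℂ A M] [IsScalarTower ℂ B M] [SMulCommClass A B M]
  {ρ : Γ →* (MvPolynomial X ℂ →ₐ[ℂ] MvPolynomial X ℂ)} {γ : MonoidAlgebra ℂ Γ →ₐ[ℂ] A}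
  {ε : M} {Ψ : M ≃ₗ[ℂ] MvPolynomial X ℂ}

/-- The element `b` of `B` has degree at most `n - e`, and vanishes if `n < e`: multiplication by
`b` takes degree `e` to degree at most `n`. -/
def RaisesTo (Ψ : M ≃ₗ[ℂ] MvPolynomial X ℂ) (ε : M) (b : B) (e n : ℕ) : Prop :=
  ∀ k, n < k + e → homogeneousComponent k (Ψ (b • ε)) = 0

namespace IsDeformation

variable (h : IsDeformation B ρ γ ε Ψ)
include h

theorem eq_zero_of_raisesTo {b : B} {e n : ℕ} (hb : RaisesTo Ψ ε b e n) (hn : n < e) : b = 0 := by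
  apply h.smul_unit_injective
  rw [← Ψ.map_eq_zero_iff]
  exact eq_zero_of_forall_homogeneousComponent fun k => hb k (by omega)

/-- Descending induction on a bound for the weighted degrees of the elements `b j` of `B`. -/
theorem eq_zero_of_descent {J : Type*} [Fintype J] {b : J → B} {δ : J → ℕ}
    (step : ∀ n, (∀ j, RaisesTo Ψ ε (b j) (δ j) n) →
      ∀ j k, n ≤ k + δ j → homogeneousComponent k (Ψ (b j • ε)) = 0) (j : J) : b j = 0 := by
  have start : ∃ n, ∀ j, RaisesTo Ψ ε (b j) (δ j) n := by
    choose n hn using fun j => exists_mem_degreeLT (Ψ (b j • ε))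
    refine ⟨∑ j, (n j + δ j), fun j k hk => mem_degreeLT.mp (hn j) k ?_⟩
    have := Finset.single_le_sum (f := fun j => n j + δ j) (fun _ _ => Nat.zero_le _)
      (Finset.mem_univ j)
    omega
  obtain ⟨n, hn⟩ := start
  induction n with
  | zero =>
    apply h.smul_unit_injective
    rw [← Ψ.map_eq_zero_iff]
    exact eq_zero_of_forall_homogeneousComponent fun k => step 0 hn j k (Nat.zero_le _)
  | succ n ih => exact ih fun j k hk => step (n + 1) hn j k hk

theorem raisesTo_smul {b : B} {e n : ℕ} (hb : RaisesTo Ψ ε b e n) {m : M}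
    (hm : Ψ m ∈ degreeLT X (e + 1)) :
    Ψ (b • m) ∈ degreeLT X (n + 1) ∧ homogeneousComponent n (Ψ (b • m))
      = (if e ≤ n then homogeneousComponent (n - e) (Ψ (b • ε)) else 0)
        * homogeneousComponent e (Ψ m) := by
  split_ifs with hn
  · have hb' : Ψ (b • ε) ∈ degreeLT X (n - e + 1) := mem_degreeLT.mpr fun k hk => hb k (by omega)
    have h1 := h.smul_mem hm hb'
    have h2 := h.component_smul hm hb'
    rw [Nat.add_sub_cancel' hn] at h1 h2
    exact ⟨h1, h2.trans (mul_comm _ _)⟩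
  · simp [h.eq_zero_of_raisesTo hb (by omega)]

theorem exists_raisesTo (hρ : IsLinearAction ρ) {c : MvPolynomial X ℂ} (hc : c ∈ invariants ρ)
    {e n : ℕ} (hce : c = 0 ∨ ∃ k, k + e = n ∧ c.IsHomogeneous k) :
    ∃ b : B, RaisesTo Ψ ε b e n ∧ ∀ m, Ψ m ∈ degreeLT X (e + 1) →
      Ψ (b • m) ∈ degreeLT X (n + 1) ∧
        homogeneousComponent n (Ψ (b • m)) = c * homogeneousComponent e (Ψ m) := by
  rcases hce with rfl | ⟨k, rfl, hk⟩
  · exact ⟨0, fun k _ => by simp, fun m _ => by simp⟩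
  · obtain ⟨b, hb, hb'⟩ := h.exists_lift hρ hc hk
    have hr : RaisesTo Ψ ε b e (k + e) := fun k' hk' => mem_degreeLT.mp hb k' (by omega)
    refine ⟨b, hr, fun m hm => ?_⟩
    have := h.raisesTo_smul hr hm
    rw [if_pos (by omega), Nat.add_sub_cancel, hb'] at this
    exact this

/-- Elements of `M` whose leading terms are independent over the invariants are independent
over `B`. -/
theorem linearIndependent_of_leading (hρ : IsLinearAction ρ) {J : Type*} [Fintype J]
    {v : J → MvPolynomial X ℂ} {δ : J → ℕ} {y : J → M}
    (hy : ∀ j, Ψ (y j) ∈ degreeLT X (δ j + 1))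
    (hyv : ∀ j, homogeneousComponent (δ j) (Ψ (y j)) = v j)
    (hv : ∀ l : J → MvPolynomial X ℂ, (∀ j, l j ∈ invariants ρ) → ∑ j, l j * v j = 0 → l = 0) :
    LinearIndependent B y := by
  rw [Fintype.linearIndependent_iff]
  intro b hb
  have step : ∀ n, (∀ j, RaisesTo Ψ ε (b j) (δ j) n) →
      ∀ j k, n ≤ k + δ j → homogeneousComponent k (Ψ (b j • ε)) = 0 := by
    intro n hn
    let l : J → MvPolynomial X ℂ := fun j =>
      if δ j ≤ n then homogeneousComponent (n - δ j) (Ψ (b j • ε)) else 0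
    have hl : l = 0 := by
      refine hv l (fun j => ?_) ?_
      · dsimp only [l]
        split_ifs with hj
        · exact h.component_mem_invariants hρ (mem_degreeLT.mpr fun k hk => hn j k (by omega))
        · exact zero_mem _
      · have h1 : homogeneousComponent n (Ψ (∑ j, b j • y j)) = 0 := by rw [hb, map_zero, map_zero]
        rw [map_sum, map_sum] at h1
        rw [← h1]
        refine Finset.sum_congr rfl fun j _ => ?_
        rw [(h.raisesTo_smul (hn j) (hy j)).2, hyv]
    intro j k hk
    rcases hk.eq_or_lt with hk | hk
    · have := congrFun hl j
      dsimp only [l] at this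
      rw [if_pos (by omega), hk, Nat.add_sub_cancel] at this
      exact this
    · exact hn j k hk
  exact h.eq_zero_of_descent step

/-- If the leading terms of the `m i` generate the polynomials over the invariants, then the `m i`
generate `M` over `B`, compatibly with the filtrations. -/
theorem exists_coeff_of_generators (hρ : IsLinearAction ρ) {r : ℕ} {f : Fin r → MvPolynomial X ℂ}
    {e : Fin r → ℕ}
    (hgen : ∀ (n : ℕ) (p : MvPolynomial X ℂ), p.IsHomogeneous n →
        ∃ c : Fin r → MvPolynomial X ℂ, (∀ i, c i ∈ invariants ρ) ∧
          (∀ i, c i = 0 ∨ ∃ k, k + e i = n ∧ (c i).IsHomogeneous k) ∧ p = ∑ i, c i * f i)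
    {y : Fin r → M} (hy : ∀ i, Ψ (y i) ∈ degreeLT X (e i + 1))
    (hyf : ∀ i, homogeneousComponent (e i) (Ψ (y i)) = f i) (n : ℕ) (m : M)
    (hm : Ψ m ∈ degreeLT X n) :
    ∃ c : Fin r → B, (∀ i k, n ≤ k + e i → homogeneousComponent k (Ψ (c i • ε)) = 0) ∧
      m = ∑ i, c i • y i := by
  induction n generalizing m with
  | zero =>
    rw [degreeLT_zero, Submodule.mem_bot, LinearEquiv.map_eq_zero_iff] at hm
    exact ⟨0, fun i k _ => by simp, by simp [hm]⟩
  | succ n ih =>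
    obtain ⟨c, hc, hce, hcf⟩ := hgen n _ (homogeneousComponent_isHomogeneous n (Ψ m))
    choose b hb hb' using fun i => h.exists_raisesTo hρ (hc i) (hce i)
    obtain ⟨c', hc', hm'⟩ := ih (m - ∑ i, b i • y i) (by
      rw [map_sub, map_sum]
      refine mem_degreeLT_of_succ (Submodule.sub_mem _ hm
        (Submodule.sum_mem _ fun i _ => (hb' i _ (hy i)).1)) ?_
      rw [map_sub, map_sum, hcf, sub_eq_zero]
      refine Finset.sum_congr rfl fun i _ => ?_
      rw [(hb' i _ (hy i)).2, hyf])
    refine ⟨fun i => c' i + b i, fun i k hk => ?_, ?_⟩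
    · rw [add_smul, map_add, map_add, hc' i k (by omega), hb i k (by omega), add_zero]
    · simp only [add_smul, Finset.sum_add_distrib, ← hm', sub_add_cancel]

/-- Elements `y j` of `M` whose leading terms span the polynomials over the invariants up to a
discriminant `D` span `M` over `B` up to a nonzero element `f`. With `β` a lift of `D` and `m i`
generators of `M`, one has `β mᵢ ≡ ∑ₖ Cᵢₖ mₖ` modulo the span of the `y j`, where `Cᵢₖ` has lower
degree than `β δᵢₖ` in the grading that makes `(mᵢ)` homogeneous; so `f = det (β - C) ≠ 0`. -/
theorem exists_ne_zero_smul_mem_span [Finite X] (hρ : IsLinearAction ρ) {J : Type*} [Fintype J]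
    {v : J → MvPolynomial X ℂ} {δ : J → ℕ} {y : J → M}
    (hy : ∀ j, Ψ (y j) ∈ degreeLT X (δ j + 1))
    (hyv : ∀ j, homogeneousComponent (δ j) (Ψ (y j)) = v j)
    {D : MvPolynomial X ℂ} {N : ℕ} (hD0 : D ≠ 0) (hD : D ∈ invariants ρ) (hDN : D.IsHomogeneous N)
    (hspan : ∀ (n : ℕ) (f : MvPolynomial X ℂ), f.IsHomogeneous n →
        ∃ l : J → MvPolynomial X ℂ, (∀ j, l j ∈ invariants ρ) ∧
          (∀ j, l j = 0 ∨ ∃ k, k + δ j = n + N ∧ (l j).IsHomogeneous k) ∧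
          f * D = ∑ j, l j * v j) :
    ∃ f : B, f ≠ 0 ∧ ∀ m : M, f • m ∈ Submodule.span B (Set.range y) := by
  classical
  have := h.isDomain
  obtain ⟨r, f, e, hf, hgen⟩ := hρ.exists_homogeneous_generators
  obtain ⟨β, hβ, hβD⟩ := h.exists_lift hρ hD hDN
  let z : Fin r → M := fun i => Ψ.symm (f i)
  have hz : ∀ i, Ψ (z i) ∈ degreeLT X (e i + 1) := fun i => by
    rw [LinearEquiv.apply_symm_apply]; exact mem_degreeLT_of_isHomogeneous (hf i)
  have hzf : ∀ i, homogeneousComponent (e i) (Ψ (z i)) = f i := fun i => by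
    rw [LinearEquiv.apply_symm_apply]; exact homogeneousComponent_eq_self (hf i)
  have hgen' := h.exists_coeff_of_generators hρ hgen hz hzf
  have hC : ∀ i, ∃ (b : J → B) (c : Fin r → B),
      (∀ k n, e i + N ≤ n + e k → homogeneousComponent n (Ψ (c k • ε)) = 0) ∧
      β • z i - ∑ j, b j • y j = ∑ k, c k • z k := by
    intro i
    obtain ⟨l, hl, hlδ, hls⟩ := hspan (e i) (f i) (hf i)
    choose b hb hb' using fun j => h.exists_raisesTo hρ (hl j) (hlδ j)
    refine ⟨b, hgen' _ _ ?_⟩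
    rw [map_sub, map_sum]
    refine mem_degreeLT_of_succ (Submodule.sub_mem _ (h.smul_mem (hz i) hβ)
        (Submodule.sum_mem _ fun j _ => (hb' j _ (hy j)).1)) ?_
    rw [map_sub, map_sum, h.component_smul (hz i) hβ, hzf, hβD, hls, sub_eq_zero]
    refine Finset.sum_congr rfl fun i _ => ?_
    rw [(hb' i _ (hy i)).2, hyv]
  choose b C hCdeg hCz using hC
  let T : Matrix (Fin r) (Fin r) B := β • (1 : Matrix (Fin r) (Fin r) B) - Matrix.of C
  have hT : ∀ i, ∑ k, T i k • z k ∈ Submodule.span B (Set.range y) := by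
    intro i
    have : ∑ k, T i k • z k = ∑ j, b i j • y j := by
      simp only [T, Matrix.sub_apply, Matrix.smul_apply, Matrix.of_apply, sub_smul,
        Finset.sum_sub_distrib, ← hCz i, Matrix.one_apply, smul_eq_mul, mul_ite, mul_one, mul_zero,
        ite_smul, zero_smul, Finset.sum_ite_eq, Finset.mem_univ, if_true, sub_sub_cancel]
    rw [this]
    exact Submodule.sum_mem _ fun j _ => Submodule.smul_mem _ _ (Submodule.subset_span ⟨j, rfl⟩)
  refine ⟨T.det, fun hdet => ?_, fun m => ?_⟩
  · obtain ⟨c, hc0, hc⟩ := Matrix.exists_vecMul_eq_zero_iff.mpr hdet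
    apply hc0
    have hc' : ∀ k, β * c k = ∑ i, C i k * c i := by
      intro k
      have h1 := congrFun hc k
      simp only [T, Matrix.vecMul_sub, Matrix.vecMul_smul, Matrix.vecMul_one, Pi.sub_apply,
        Pi.smul_apply, smul_eq_mul, Pi.zero_apply, sub_eq_zero] at h1
      rw [h1, Matrix.vecMul, dotProduct]
      exact Finset.sum_congr rfl fun i _ => mul_comm _ _
    have step : ∀ n, (∀ i, RaisesTo Ψ ε (c i) (e i) n) →
        ∀ i k, n ≤ k + e i → homogeneousComponent k (Ψ (c i • ε)) = 0 := by
      intro n hn i k hk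
      rcases hk.eq_or_lt with hk | hk
      · have h1 : Ψ (c i • ε) ∈ degreeLT X (k + 1) :=
          mem_degreeLT.mpr fun k' hk' => hn i k' (by omega)
        have h2 := h.component_smul h1 hβ
        have h3 : Ψ ((β * c i) • ε) ∈ degreeLT X (k + N) := by
          rw [hc', Finset.sum_smul, map_sum]
          refine Submodule.sum_mem _ fun j _ => ?_
          rcases lt_or_ge n (e j) with hj | hj
          · rw [h.eq_zero_of_raisesTo (hn j) hj, mul_zero, zero_smul, map_zero]
            exact Submodule.zero_mem _
          rcases lt_or_ge (e j + N) (e i) with hij | hij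
          · rw [h.eq_zero_of_raisesTo (b := C j i) (e := e i) (n := e j + N)
              (fun k' hk' => hCdeg j i k' hk'.le) hij, zero_mul, zero_smul, map_zero]
            exact Submodule.zero_mem _
          have h4 : Ψ (C j i • ε) ∈ degreeLT X (e j + N - e i) :=
            mem_degreeLT.mpr fun k' hk' => hCdeg j i k' (by omega)
          have h5 : Ψ (c j • ε) ∈ degreeLT X (n - e j + 1) :=
            mem_degreeLT.mpr fun k' hk' => hn j k' (by omega)
          have h6 := h.smul_mem_left h4 h5
          rw [mul_comm, mul_smul]
          exact degreeLT_mono (by omega) h6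
        rw [← mul_smul, mem_degreeLT.mp h3 _ le_rfl, hβD] at h2
        exact (mul_eq_zero.mp h2.symm).resolve_right hD0
      · exact hn i k hk
    exact funext (h.eq_zero_of_descent step)
  · -- multiply the relations by the adjugate matrix
    have hz' : ∀ i, T.det • z i ∈ Submodule.span B (Set.range y) := by
      intro i
      have : T.det • z i = ∑ k, T.adjugate i k • ∑ l, T k l • z l := by
        simp only [Finset.smul_sum, smul_smul]
        rw [Finset.sum_comm]
        simp only [← Finset.sum_smul]
        have h1 : ∀ l, ∑ k, T.adjugate i k * T k l = if i = l then T.det else 0 := fun l => by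
          rw [← Matrix.mul_apply, Matrix.adjugate_mul, Matrix.smul_apply, Matrix.one_apply]
          simp
        simp [h1]
      rw [this]
      exact Submodule.sum_mem _ fun k _ => Submodule.smul_mem _ _ (hT k)
    obtain ⟨n, hn⟩ := exists_mem_degreeLT (Ψ m)
    obtain ⟨c, -, rfl⟩ := hgen' n m hn
    rw [Finset.smul_sum]
    refine Submodule.sum_mem _ fun i _ => ?_
    rw [smul_comm]
    exact Submodule.smul_mem _ _ (hz' i)

end IsDeformation

end GenericFreeness

/-! ### Generic fibres are regular representations -/

section Fibres

set_option linter.unusedSectionVars false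

open MvPolynomial TensorProduct

section Basis

variable {B : Type*} [CommRing B] [Algebra ℂ B] {M : Type*} [AddCommGroup M] [Module ℂ M]
  [Module B M] [IsScalarTower ℂ B M] {J : Type*} [Fintype J] {y : J → M} {f : B} {m : Ideal B}

/-- Elements that form a basis of `M` after inverting `f` restrict to a basis of the fibre of `M` at
every maximal ideal with residue field `ℂ` that does not contain `f`. -/
theorem bijective_sum_tmul (hy : LinearIndependent B y)
    (hf : ∀ x : M, f • x ∈ Submodule.span B (Set.range y)) [m.IsMaximal]
    (hres : ∀ b : B, ∃ c : ℂ, b - algebraMap ℂ B c ∈ m) (hfm : f ∉ m) :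
    Function.Bijective fun l : J → ℂ => (∑ j, l j • y j) ⊗ₜ[B] (1 : B ⧸ m) := by
  classical
  have hmk : ∀ (b : B) (x : M), (b • x) ⊗ₜ[B] (1 : B ⧸ m) = x ⊗ₜ Ideal.Quotient.mk m b :=
    fun b x => by
      rw [TensorProduct.smul_tmul, ← Ideal.Quotient.mk_eq_mk, ← mul_one b]
      simp [Algebra.smul_def]
  constructor
  · intro l l' hl
    let τ : M →ₗ[B] J →₀ B :=
      hy.repr ∘ₗ ((f • LinearMap.id : M →ₗ[B] M).codRestrict _ fun x => hf x)
    have hτ : ∀ l : J → ℂ, ∀ j, τ (∑ j, l j • y j) j = f * algebraMap ℂ B (l j) := by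
      intro l j
      have h1 : ∀ k, τ (y k) = Finsupp.single k f := fun k => by
        have h2 : ((f • LinearMap.id : M →ₗ[B] M).codRestrict _ fun x => hf x) (y k)
            = f • (⟨y k, Submodule.subset_span ⟨k, rfl⟩⟩ : Submodule.span B (Set.range y)) := rfl
        rw [LinearMap.comp_apply, h2]
        change hy.repr _ = _
        rw [map_smul, hy.repr_eq_single k _ rfl, Finsupp.smul_single, smul_eq_mul, mul_one]
      simp only [map_sum, ← algebraMap_smul B (l _) (y _), map_smul, h1, Finsupp.finsetSum_apply,
        Finsupp.smul_apply, Finsupp.single_apply, smul_eq_mul, mul_ite, mul_zero,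
        Finset.sum_ite_eq', Finset.mem_univ, if_true, mul_comm f]
    funext j
    have h1 := congrArg (TensorProduct.lid B (B ⧸ m) ∘ (Finsupp.lapply j ∘ₗ τ).rTensor (B ⧸ m)) hl
    simp only [Function.comp_apply, LinearMap.rTensor_tmul, TensorProduct.lid_tmul,
      LinearMap.comp_apply, Finsupp.lapply_apply, hτ] at h1
    rw [Algebra.smul_def, Algebra.smul_def, mul_one, mul_one, Ideal.Quotient.algebraMap_eq,
      Ideal.Quotient.eq, ← mul_sub, ← map_sub] at h1
    have h2 := ((Ideal.IsMaximal.isPrime ‹_›).mem_or_mem h1).resolve_left hfm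
    by_contra hne
    exact (Ideal.IsPrime.ne_top inferInstance) (Ideal.eq_top_of_isUnit_mem m h2
      ((isUnit_iff_ne_zero.mpr (sub_ne_zero.mpr hne)).map (algebraMap ℂ B)))
  · obtain ⟨g, hg⟩ := Ideal.Quotient.exists_inv
      (fun h0 => hfm (Ideal.Quotient.eq_zero_iff_mem.mp h0) : Ideal.Quotient.mk m f ≠ 0)
    obtain ⟨g, rfl⟩ := Ideal.Quotient.mk_surjective g
    intro z
    induction z with
    | zero => exact ⟨0, by simp⟩
    | add z z' hz hz' =>
      obtain ⟨l, rfl⟩ := hz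
      obtain ⟨l', rfl⟩ := hz'
      exact ⟨l + l', by simp [add_smul, Finset.sum_add_distrib, TensorProduct.add_tmul]⟩
    | tmul x r =>
      obtain ⟨r, rfl⟩ := Ideal.Quotient.mk_surjective r
      obtain ⟨β, hβ⟩ := (Submodule.mem_span_range_iff_exists_fun B).mp
        (Submodule.smul_mem _ (r * g) (hf x))
      choose l hl using fun j => hres (β j)
      refine ⟨l, ?_⟩
      have h1 : x ⊗ₜ[B] Ideal.Quotient.mk m r = (∑ j, β j • y j) ⊗ₜ[B] (1 : B ⧸ m) := by
        rw [hβ, ← mul_smul, hmk, mul_assoc, map_mul, map_mul, mul_comm (Ideal.Quotient.mk m g), hg,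
          mul_one]
      simp only [h1, TensorProduct.sum_tmul, ← algebraMap_smul B (l _) (y _), hmk]
      exact Finset.sum_congr rfl fun j _ => by rw [Ideal.Quotient.eq.mpr (hl j)]

end Basis

variable {Γ : Type*} [Group Γ] [Fintype Γ] {X : Type*} [Finite X]
  {A : Type*} [Ring A] [Algebra ℂ A]
  {B : Type*} [CommRing B] [Algebra ℂ B]
  {M : Type*} [AddCommGroup M] [Module ℂ M] [Module A M] [Module B M]
  [IsScalarTower ℂ A M] [IsScalarTower ℂ B M] [SMulCommClass A B M]
  {ρ : Γ →* (MvPolynomial X ℂ →ₐ[ℂ] MvPolynomial X ℂ)} {γ : MonoidAlgebra ℂ Γ →ₐ[ℂ] A}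
  {ε : M} {Ψ : M ≃ₗ[ℂ] MvPolynomial X ℂ}

/-- There is an element `U` of `M` whose translates by the matrix units of `ℂΓ` form a basis of `M`
after inverting some `f ≠ 0` in `B`. -/
theorem IsDeformation.exists_generic_basis (h : IsDeformation B ρ γ ε Ψ) (hρ : IsLinearAction ρ)
    {ξ : X → ℂ}
    (hξ : Function.Injective fun (g : Γ) (x : X) => aeval (R := ℂ) ξ (ρ g (MvPolynomial.X x)))
    {n : ℕ} {d : Fin n → ℕ} [∀ i, NeZero (d i)]
    (w : MonoidAlgebra ℂ Γ ≃ₐ[ℂ] Π i, Matrix (Fin (d i)) (Fin (d i)) ℂ) :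
    ∃ U : M, LinearIndependent B (fun j => γ (matrixUnitBasis w j) • U) ∧
      ∃ f : B, f ≠ 0 ∧
        ∀ x : M, f • x ∈ Submodule.span B (Set.range fun j => γ (matrixUnitBasis w j) • U) := by
  classical
  choose q δ hqδ hq hli using exists_homogeneous_seeds w hξ hρ
  have hind := linearIndependent_orbitEval_frameElem w hq hli
  let u : ∀ i, Fin (d i) → M := fun i c => Ψ.symm (q i c)
  have hu : ∀ i c, Ψ (u i c) ∈ degreeLT X (δ i c + 1) := fun i c => by
    rw [LinearEquiv.apply_symm_apply]; exact mem_degreeLT_of_isHomogeneous (hqδ i c)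
  have huq : ∀ i c, homogeneousComponent (δ i c) (Ψ (u i c)) = q i c := fun i c => by
    rw [LinearEquiv.apply_symm_apply]; exact homogeneousComponent_eq_self (hqδ i c)
  let U : M := ∑ i, ∑ c, γ (matrixUnit w i c 0) • u i c
  have hU : ∀ j : UnitIndex d, γ (matrixUnitBasis w j) • U
      = γ (matrixUnit w j.1 j.2.1 0) • u j.1 j.2.2 := by
    rintro ⟨i, a, c⟩
    simp only [matrixUnitBasis_apply, U, Finset.smul_sum, smul_smul, ← map_mul]
    rw [Finset.sum_eq_single_of_mem i (Finset.mem_univ i),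
      Finset.sum_eq_single_of_mem c (Finset.mem_univ c), matrixUnit_mul_same]
    · intro c' _ hc'
      rw [matrixUnit_mul_of_ne w i a c c' 0 hc'.symm, map_zero, zero_smul]
    · intro i' _ hi'
      refine Finset.sum_eq_zero fun c' _ => ?_
      rw [matrixUnit_mul_of_ne_index w hi'.symm, map_zero, zero_smul]
  have hhom : ∀ j, (frameElem (ρ := ρ) w q j).IsHomogeneous (δ j.1 j.2.2) := fun j =>
    hρ.isHomogeneous_polyAction _ (hqδ _ _)
  obtain ⟨⟨D, N, hD0, hD, hDN, hspan⟩, hinv⟩ :=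
    hρ.exists_discriminant ξ (card_unitIndex w) hhom hind
  have hy : ∀ j : UnitIndex d,
      Ψ (γ (matrixUnitBasis w j) • U) ∈ degreeLT X (δ j.1 j.2.2 + 1) := fun j => by
    rw [hU]; exact (h.act_mem hρ (hu _ _) _).1
  have hyv : ∀ j : UnitIndex d, homogeneousComponent (δ j.1 j.2.2)
      (Ψ (γ (matrixUnitBasis w j) • U)) = frameElem (ρ := ρ) w q j := fun j => by
    rw [hU, (h.act_mem hρ (hu _ _) _).2, huq]; rfl
  exact ⟨U, h.linearIndependent_of_leading hρ hy hyv hinv,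
    h.exists_ne_zero_smul_mem_span hρ hy hyv hD0 hD hDN hspan⟩

/-- Away from the zero locus of some `f ≠ 0` in `B`, the fibres of `M` are free `ℂΓ`-modules of
rank one. -/
theorem IsDeformation.exists_regular_fibres [SMulCommClass B A M]
    (h : IsDeformation B ρ γ ε Ψ) (hρ : IsLinearAction ρ)
    {ξ : X → ℂ}
    (hξ : Function.Injective fun (g : Γ) (x : X) => aeval (R := ℂ) ξ (ρ g (MvPolynomial.X x))) :
    ∃ f : B, f ≠ 0 ∧ ∀ m : Ideal B, m.IsMaximal → f ∉ m →
      ∃ z : M ⊗[B] (B ⧸ m), Function.Bijective fun a : MonoidAlgebra ℂ Γ => γ a • z := by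
  have : NeZero (Nat.card Γ : ℂ) := ⟨Nat.cast_ne_zero.mpr Nat.card_pos.ne'⟩
  obtain ⟨n, d, hd, ⟨w⟩⟩ :=
    IsSemisimpleRing.exists_algEquiv_pi_matrix_of_isAlgClosed ℂ (MonoidAlgebra ℂ Γ)
  obtain ⟨U, hU, f, hf0, hf⟩ := h.exists_generic_basis hρ hξ w
  refine ⟨f, hf0, fun m hm hfm => ⟨U ⊗ₜ 1, ?_⟩⟩
  convert (bijective_sum_tmul hU hf (h.exists_sub_algebraMap_mem hρ m) hfm).comp
    (matrixUnitBasis w).equivFun.bijective using 1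
  funext a
  rw [Function.comp_apply, TensorProduct.smul_tmul']
  congr 1
  conv_lhs => rw [← (matrixUnitBasis w).sum_equivFun a]
  simp only [map_sum, map_smul, Finset.sum_smul, smul_assoc]

end Fibres

/-! ### The linear action of `G` on `S(V)` -/

section SymmetricAlgebra

open TensorAlgebra MvPolynomial

variable {V : Type*} [AddCommGroup V] [Module ℂ V]
  {G : Subgroup (LinearMap.GeneralLinearGroup ℂ V)} {X : Type*} (b : Module.Basis X ℂ V)

theorem commImage_ι (v : V) : commImage b (ι ℂ v) = b.constr ℂ MvPolynomial.X v := by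
  simp [commImage]

theorem isHomogeneous_commImage_ι (v : V) : (commImage b (ι ℂ v)).IsHomogeneous 1 := by
  rw [commImage_ι, Module.Basis.constr_apply]
  refine IsHomogeneous.sum _ _ _ fun x _ => ?_
  beta_reduce
  rw [smul_eq_C_mul]
  exact (isHomogeneous_X ℂ x).C_mul _

/-- The algebra endomorphism of `S(V)` induced by `g ∈ G`. -/
def symEnd (g : G) : MvPolynomial X ℂ →ₐ[ℂ] MvPolynomial X ℂ :=
  aeval fun x => commImage b (ι ℂ (g • b x))

theorem symEnd_commImage (g : G) (t : TensorAlgebra ℂ V) :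
    symEnd b g (commImage b t) = commImage b (g • t) := by
  let T : TensorAlgebra ℂ V →ₐ[ℂ] TensorAlgebra ℂ V :=
    TensorAlgebra.lift ℂ (ι ℂ ∘ₗ ((g : LinearMap.GeneralLinearGroup ℂ V) : Module.End ℂ V))
  have hT : ∀ t, T t = g • t := fun _ => rfl
  have h : (symEnd b g).comp (commImage b) = (commImage b).comp T := by
    apply TensorAlgebra.hom_ext
    refine b.ext fun x => ?_
    simp only [LinearMap.comp_apply, AlgHom.toLinearMap_apply, AlgHom.comp_apply, hT,
      tensorAction_ι, commImage_ι_basis, symEnd, aeval_X]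
  exact AlgHom.congr_fun h t

/-- The action of `G` on `S(V)`, identified with a polynomial ring by the basis `b`. -/
def symAct : G →* (MvPolynomial X ℂ →ₐ[ℂ] MvPolynomial X ℂ) where
  toFun := symEnd b
  map_one' := by
    ext x : 1
    rw [← commImage_ι_basis b, symEnd_commImage, one_smul]
    rfl
  map_mul' g h := by
    ext x : 1
    rw [← commImage_ι_basis b, AlgHom.mul_apply, symEnd_commImage, symEnd_commImage,
      symEnd_commImage, mul_smul]

theorem symAct_commImage (g : G) (t : TensorAlgebra ℂ V) :
    symAct b g (commImage b t) = commImage b (g • t) := symEnd_commImage b g t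

theorem isLinearAction_symAct : IsLinearAction (symAct (G := G) b) := fun g x => by
  rw [← commImage_ι_basis b, symAct_commImage, tensorAction_ι]
  exact isHomogeneous_commImage_ι b _

theorem aeval_symAct_X (f : Module.Dual ℂ V) (g : G) (x : X) :
    aeval (fun x => f (b x)) (symAct b g (MvPolynomial.X x)) = f (g • b x) := by
  rw [← commImage_ι_basis b, symAct_commImage, tensorAction_ι, commImage_ι]
  have : (aeval fun x => f (b x)).toLinearMap ∘ₗ b.constr ℂ MvPolynomial.X = f :=
    b.ext fun x => by simp
  exact LinearMap.congr_fun this _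

/-- Some linear functional on `V` has trivial stabilizer in `G`. -/
theorem exists_free_orbit [Finite G] :
    ∃ ξ : X → ℂ, Function.Injective fun (g : G) (x : X) =>
      aeval (R := ℂ) ξ (symAct b g (MvPolynomial.X x)) := by
  let W : G × G → Submodule ℂ (Module.Dual ℂ V) := fun p =>
    LinearMap.ker (Module.Dual.transpose (R := ℂ)
      (((p.1 : LinearMap.GeneralLinearGroup ℂ V) : Module.End ℂ V)
        - ((p.2 : LinearMap.GeneralLinearGroup ℂ V) : Module.End ℂ V)))
  have hW : ∀ p f, f ∈ W p ↔ ∀ v, f (p.1 • v) = f (p.2 • v) := by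
    intro p f
    rw [LinearMap.mem_ker, LinearMap.ext_iff]
    refine forall_congr' fun v => ?_
    rw [Module.Dual.transpose_apply, LinearMap.comp_apply, LinearMap.sub_apply, map_sub,
      LinearMap.zero_apply, sub_eq_zero]
    rfl
  -- the functionals that do not separate `g` and `h` form proper subspaces of the dual space, and
  -- finitely many of these do not cover it
  have hfin : {p : G × G | p.1 ≠ p.2}.Finite := Set.toFinite _
  let s : Finset (Submodule ℂ (Module.Dual ℂ V)) := (hfin.image W).toFinset
  have htop : ⊤ ∉ s := by
    intro hs
    obtain ⟨p, hp, hpW⟩ := (Set.Finite.mem_toFinset _).mp hs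
    refine hp (Subtype.ext (Units.ext (LinearMap.ext fun v => ?_)))
    rw [← sub_eq_zero, ← Module.forall_dual_apply_eq_zero_iff ℂ]
    intro f
    have hf : f ∈ W p := hpW ▸ Submodule.mem_top
    rw [map_sub, sub_eq_zero]
    exact (hW p f).mp hf v
  have h1 := Subspace.biUnion_ne_univ_of_top_notMem htop
  obtain ⟨f, hf⟩ := (Set.ne_univ_iff_exists_notMem _).mp h1
  refine ⟨fun x => f (b x), fun g h hgh => ?_⟩
  by_contra hne
  refine hf (Set.mem_biUnion ((Set.Finite.mem_toFinset _).mpr ⟨(g, h), hne, rfl⟩) ?_)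
  refine (hW _ _).mpr fun v => ?_
  have h2 : f ∘ₗ ((g : LinearMap.GeneralLinearGroup ℂ V) : Module.End ℂ V)
      = f ∘ₗ ((h : LinearMap.GeneralLinearGroup ℂ V) : Module.End ℂ V) :=
    b.ext fun x => by
      have := congrFun hgh x
      dsimp only at this
      rwa [aeval_symAct_X, aeval_symAct_X] at this
  exact LinearMap.congr_fun h2 v

theorem degreeDrop_one_le (n : ℕ) : degreeDrop X n 1 ≤ degreeLT X n := fun p hp => by
  rcases mem_degreeDrop.mp hp with rfl | h
  · exact Submodule.zero_mem _
  · exact mem_degreeLT_of_totalDegree_lt (by omega)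

theorem commImage_sortedLift [LinearOrder X] (p : MvPolynomial X ℂ) :
    commImage b (sortedLift b p) = p := by
  have : (commImage b).toLinearMap ∘ₗ sortedLift b = LinearMap.id := by
    refine (basisMonomials X ℂ).ext fun m => ?_
    rw [coe_basisMonomials, LinearMap.comp_apply, sortedLift_monomial, AlgHom.toLinearMap_apply,
      commImage_word]
    simp
  exact LinearMap.congr_fun this p

end SymmetricAlgebra

/-! ### The left ideal `Ae` as a deformation of `S(V)` -/

section SphericalAlgebra

open TensorAlgebra MvPolynomial

variable {V : Type*} [AddCommGroup V] [Module ℂ V]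
  (G : Subgroup (LinearMap.GeneralLinearGroup ℂ V)) [Finite G] (κ : V → V → MonoidAlgebra ℂ G)

/-- The idempotent `e` as an element of `Ae`. -/
def leftUnit : LeftIdeal G κ := ⟨idem G κ, Ideal.subset_span rfl⟩

theorem smul_leftUnit_coe [IsMulCommutative (Spherical G κ)] (b : Spherical G κ) :
    ((b • leftUnit G κ : LeftIdeal G κ) : HeckeAlgebra G κ) = b.1 := by
  change idem G κ * b.1 = b.1
  obtain ⟨r, hr⟩ := b.2
  rw [← hr]
  change idem G κ * (idem G κ * r * idem G κ) = _
  rw [← mul_assoc, ← mul_assoc, (idem_isIdempotentElem G κ).eq]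

theorem spherical_smul_coe [IsMulCommutative (Spherical G κ)] (b : Spherical G κ)
    (x : LeftIdeal G κ) : ((b • x : LeftIdeal G κ) : HeckeAlgebra G κ) = x.1 * b.1 := rfl

/-- The ring homomorphism `ℂ → eAe`, `c ↦ c e`. -/
def scalarHom : ℂ →+* Spherical G κ where
  toFun c := ⟨c • idem G κ, c • 1, by
    simp [(idem_isIdempotentElem G κ).eq]⟩
  map_one' := Subtype.ext (one_smul ℂ _)
  map_mul' c c' := Subtype.ext (by
    change (c * c') • idem G κ = c • idem G κ * c' • idem G κ
    rw [smul_mul_smul_comm, (idem_isIdempotentElem G κ).eq])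
  map_zero' := Subtype.ext (zero_smul ℂ _)
  map_add' c c' := Subtype.ext (add_smul c c' _)

variable [IsMulCommutative (Spherical G κ)]

instance : Algebra ℂ (Spherical G κ) := (scalarHom G κ).toAlgebra

theorem scalar_smul_leftIdeal (c : ℂ) (x : LeftIdeal G κ) :
    algebraMap ℂ (Spherical G κ) c • x = c • x := by
  apply Subtype.ext
  rw [spherical_smul_coe]
  obtain ⟨a, ha⟩ := Ideal.mem_span_singleton'.mp x.2
  change x.1 * c • idem G κ = c • x.1
  rw [mul_smul_comm, ← ha, mul_assoc, (idem_isIdempotentElem G κ).eq]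

instance : IsScalarTower ℂ (Spherical G κ) (LeftIdeal G κ) where
  smul_assoc c b x := by
    rw [Algebra.smul_def, mul_smul, scalar_smul_leftIdeal]

end SphericalAlgebra

section Deformation

open TensorAlgebra MvPolynomial

variable {V : Type*} [AddCommGroup V] [Module ℂ V]
  {G : Subgroup (LinearMap.GeneralLinearGroup ℂ V)} [Fintype G] {κ : V → V → MonoidAlgebra ℂ G}
  {X : Type*} [LinearOrder X] (b : Module.Basis X ℂ V)
  {K : G → LinearMap.BilinForm ℂ V}
  (hκ : ∀ v w, κ v w = ∑ s : G, MonoidAlgebra.single s (K s v w)) (hK : IsGroupBracket K)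

theorem leftIdealEquiv_toLeftIdeal_sub_mem {n : ℕ} {t : TensorAlgebra ℂ V}
    (ht : t ∈ wordsLE b n) :
    leftIdealEquiv hκ b hK (toLeftIdeal κ t) - commImage b t ∈ degreeLT X n := by
  rw [leftIdealEquiv_toLeftIdeal]
  exact degreeDrop_one_le n (normalForm_sub_commImage_mem b K ht)

/-- The algebra `eAe` and its bimodule `Ae` deform `S(V)^G` and `S(V)`. -/
theorem isDeformation_leftIdealEquiv [IsMulCommutative (Spherical G κ)] :
    IsDeformation (Spherical G κ) (symAct b) (groupAlgebraHom G κ) (leftUnit G κ)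
      (leftIdealEquiv hκ b hK) := by
  set Ψ := leftIdealEquiv hκ b hK with hΨ
  have hlift : ∀ x, toLeftIdeal κ (sortedLift b (Ψ x)) = x := fun x => by
    rw [← leftIdealEquiv_symm_apply hκ b hK, hΨ, LinearEquiv.symm_apply_apply]
  have hmem : ∀ {n : ℕ} {x : LeftIdeal G κ}, Ψ x ∈ degreeLT X (n + 1) →
      sortedLift b (Ψ x) ∈ wordsLE b n := fun h =>
    sortedLift_mem b (mem_degreeLT_iff_totalDegree.mp h)
  have hact : ∀ (g : G) (x : LeftIdeal G κ), groupAlgebraHom G κ (MonoidAlgebra.single g 1) • x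
      = toLeftIdeal κ (g • sortedLift b (Ψ x)) := fun g x => by
    rw [toLeftIdeal_smul, hlift]; rfl
  refine ⟨?_, fun β hβ => ?_, fun β g => ?_, fun x hx => ?_, fun {n k x β} hx hβ => ?_,
    fun {n x} g hx => ?_⟩
  · have h1 : leftUnit G κ = toLeftIdeal κ (word b []) := Subtype.ext (by
      rw [coe_toLeftIdeal, word_nil, map_one, one_mul]; rfl)
    rw [h1, hΨ, leftIdealEquiv_toLeftIdeal, normalForm_sorted b K List.Pairwise.nil, word_nil,
      map_one]
  · apply Subtype.ext
    rw [← smul_leftUnit_coe, hβ]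
    rfl
  · apply Subtype.ext
    change groupElem κ g * (idem G κ * β.1) = idem G κ * β.1
    rw [← mul_assoc, groupElem_mul_idem]
  · have h1 : idem G κ * x.1 = x.1 := by
      have h2 : ∀ g : G, groupElem κ g * x.1 = x.1 := fun g => congrArg Subtype.val (hx g)
      refine (congrArg (· * x.1) (idem_eq_sum κ)).trans ?_
      rw [smul_mul_assoc, Finset.sum_mul]
      simp only [h2]
      rw [Finset.sum_const, Finset.card_univ, Nat.card_eq_fintype_card, ← Nat.cast_smul_eq_nsmul ℂ,
        smul_smul, inv_mul_cancel₀ (Nat.cast_ne_zero.mpr Fintype.card_ne_zero), one_smul]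
    have h2 : idem G κ * x.1 * idem G κ = x.1 := by
      obtain ⟨a, ha⟩ := Ideal.mem_span_singleton'.mp x.2
      rw [h1, ← ha, mul_assoc, (idem_isIdempotentElem G κ).eq]
    exact ⟨⟨x.1, x.1, h2⟩, Subtype.ext (smul_leftUnit_coe G κ _)⟩
  · have h1 : β • x
        = toLeftIdeal κ (sortedLift b (Ψ x) * sortedLift b (Ψ (β • leftUnit G κ))) := by
      apply Subtype.ext
      have h2 := congrArg Subtype.val (hlift x)
      have h3 := congrArg Subtype.val (hlift (β • leftUnit G κ))
      rw [smul_leftUnit_coe, coe_toLeftIdeal] at h3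
      rw [coe_toLeftIdeal] at h2
      have h4 : idem G κ * β.1 = β.1 := smul_leftUnit_coe G κ β
      rw [coe_toLeftIdeal, map_mul, mul_assoc, h3, spherical_smul_coe]
      exact ((congrArg (· * β.1) h2.symm).trans (mul_assoc _ _ _)).trans (congrArg (_ * ·) h4)
    have h2 := leftIdealEquiv_toLeftIdeal_sub_mem b hκ hK
      (mul_mem_wordsLE b (hmem hx) (hmem hβ))
    rwa [map_mul (commImage b), commImage_sortedLift, commImage_sortedLift, ← h1] at h2
  · have h1 := leftIdealEquiv_toLeftIdeal_sub_mem b hκ hK (smul_mem_wordsLE b (hmem hx) g)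
    rwa [← hact, ← symAct_commImage, commImage_sortedLift] at h1

end Deformation

/-! ### The bracket `κ` -/

section Bracket

variable {V : Type*} [AddCommGroup V] [Module ℂ V]
  {G : Subgroup (LinearMap.GeneralLinearGroup ℂ V)}

theorem mem_fixedSpace {s : G} {v : V} :
    v ∈ fixedSpace (s : LinearMap.GeneralLinearGroup ℂ V) ↔ s • v = v := by
  rw [fixedSpace, LinearMap.mem_ker, LinearMap.sub_apply, sub_eq_zero, eq_comm]
  rfl

/-- A skew form whose radical is the fixed space of a bireflection `s` satisfies the Jacobi identity
for `s`: three vectors are dependent modulo `V^s`, as this space has codimension two. -/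
theorem jacobi_of_ker_eq_fixedSpace {s : G} (hs : s ∈ bireflections G) {ω : LinearMap.BilinForm ℂ V}
    (hω : ω.IsAlt) (hker : LinearMap.ker ω = fixedSpace (s : LinearMap.GeneralLinearGroup ℂ V))
    (x y z : V) :
    ω x y • (s • z - z) + ω z x • (s • y - y) + ω y z • (s • x - x) = 0 := by
  set f : V →ₗ[ℂ] V := 1 - ((s : LinearMap.GeneralLinearGroup ℂ V) : Module.End ℂ V) with hf
  have hdep : ¬ LinearIndependent ℂ fun i => f.rangeRestrict (![x, y, z] i) := by
    intro hli
    have hs2 : Module.finrank ℂ (LinearMap.range f) = 2 := hs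
    have : Module.Finite ℂ (LinearMap.range f) := Module.finite_of_finrank_pos (by omega)
    have := hli.fintype_card_le_finrank
    rw [hs2, Fintype.card_fin] at this
    omega
  rw [Fintype.not_linearIndependent_iff] at hdep
  obtain ⟨l, hl, i, hi⟩ := hdep
  have hrel : l 0 • x + l 1 • y + l 2 • z ∈ LinearMap.ker ω := by
    rw [hker]
    have h1 := congrArg Subtype.val hl
    simp only [← map_smul, ← map_sum] at h1
    rw [Fin.sum_univ_three] at h1
    exact h1
  set r : V := l 0 • x + l 1 • y + l 2 • z with hr
  rw [LinearMap.mem_ker] at hrel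
  have hx : l 1 * ω y x + l 2 * ω z x = 0 := by
    have := LinearMap.congr_fun hrel x
    simpa [hr, hω.self_eq_zero x] using this
  have hy : l 0 * ω x y + l 2 * ω z y = 0 := by
    have := LinearMap.congr_fun hrel y
    simpa [hr, hω.self_eq_zero y] using this
  have hz : l 0 * ω x z + l 1 * ω y z = 0 := by
    have := LinearMap.congr_fun hrel z
    simpa [hr, hω.self_eq_zero z] using this
  rw [← hω.neg_eq x y] at hx
  rw [← hω.neg_eq y z] at hy
  rw [← hω.neg_eq z x] at hz
  set u : V := ω x y • z + ω z x • y + ω y z • x with hu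
  -- pairing the relation `r` with `x`, `y` and `z` shows that `u` is proportional to `r`
  have hmul : ∀ j, l j • u ∈ LinearMap.ker ω := by
    have h0 : l 0 • u = ω y z • r := by
      rw [hu, hr]; linear_combination (norm := module) hy • z - hz • y
    have h1 : l 1 • u = ω z x • r := by
      rw [hu, hr]; linear_combination (norm := module) hz • x - hx • z
    have h2 : l 2 • u = ω x y • r := by
      rw [hu, hr]; linear_combination (norm := module) hx • y - hy • x
    intro j
    have hr' : r ∈ LinearMap.ker ω := hrel
    fin_cases j
    · exact h0 ▸ Submodule.smul_mem _ _ hr'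
    · exact h1 ▸ Submodule.smul_mem _ _ hr'
    · exact h2 ▸ Submodule.smul_mem _ _ hr'
  have hmem : u ∈ fixedSpace (s : LinearMap.GeneralLinearGroup ℂ V) := by
    rw [← hker]
    exact (Submodule.smul_mem_iff _ hi).mp (hmul i)
  rw [mem_fixedSpace] at hmem
  rw [← sub_eq_zero.mpr hmem, hu]
  simp only [smul_add, smul_sub, smul_comm s]
  abel

theorem conj_mem_admissible {s : G} (hs : s ∈ admissible G) (g : G) :
    g⁻¹ * s * g ∈ admissible G := by
  let e : V ≃ₗ[ℂ] V := LinearMap.GeneralLinearGroup.generalLinearEquiv ℂ V g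
  have he : ∀ v, e v = g • v := fun _ => rfl
  have hfix : (fixedSpace ((g⁻¹ * s * g : G) : LinearMap.GeneralLinearGroup ℂ V)).map
      (e : V →ₗ[ℂ] V) = fixedSpace (s : LinearMap.GeneralLinearGroup ℂ V) := by
    ext v
    rw [Submodule.mem_map_equiv, mem_fixedSpace, mem_fixedSpace]
    obtain ⟨w, rfl⟩ := e.surjective v
    rw [LinearEquiv.symm_apply_apply, he, mul_smul, mul_smul, inv_smul_eq_iff]
  refine ⟨?_, fun h hh => ?_⟩
  · have h1 := hs.1
    change Module.finrank ℂ _ = 2 at h1 ⊢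
    rw [← h1]
    rw [← (LinearMap.quotKerEquivRange _).finrank_eq, ← (LinearMap.quotKerEquivRange _).finrank_eq]
    exact (Submodule.Quotient.equiv _ _ e hfix).finrank_eq
  · have hcomm : Commute ((g * h * g⁻¹ : G) : LinearMap.GeneralLinearGroup ℂ V) s := by
      have h1 : h * (g⁻¹ * s * g) = g⁻¹ * s * g * h := Subtype.ext hh
      have h2 : g * h * g⁻¹ * s = s * (g * h * g⁻¹) := by
        calc g * h * g⁻¹ * s = g * (h * (g⁻¹ * s * g)) * g⁻¹ := by group
          _ = s * (g * h * g⁻¹) := by rw [h1]; group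
      exact congrArg Subtype.val h2
    rw [← hs.2 _ hcomm, ← LinearMap.det_conj _ (Submodule.Quotient.equiv _ _ e hfix)]
    congr 1
    refine LinearMap.ext fun v => ?_
    obtain ⟨v, rfl⟩ := (Submodule.Quotient.equiv _ _ e hfix).surjective v
    obtain ⟨v, rfl⟩ := Submodule.Quotient.mk_surjective _ v
    rw [LinearMap.comp_apply, LinearMap.comp_apply, LinearEquiv.coe_coe, LinearEquiv.coe_coe,
      LinearEquiv.symm_apply_apply]
    change Submodule.Quotient.mk (g • h • v) = Submodule.Quotient.mk ((g * h * g⁻¹) • g • v)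
    rw [mul_smul, mul_smul, inv_smul_smul]

theorem conj_mem_admissible_iff {s : G} (g : G) :
    g⁻¹ * s * g ∈ admissible G ↔ s ∈ admissible G := by
  refine ⟨fun h => ?_, fun h => conj_mem_admissible h g⟩
  have := conj_mem_admissible h g⁻¹
  rwa [show g⁻¹⁻¹ * (g⁻¹ * s * g) * g⁻¹ = s by group] at this

variable {N : ℕ} (b : Fin N → LinearMap.BilinForm ℂ V) (t : Fin N → ℂ) (Ω : BireflectionForms G)
  (c : admissible G → ℂ)

open Classical in
/-- The coefficient of `s ∈ G` in `κ`, a skew form on `V`. -/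
def kappaCoeff (s : G) : LinearMap.BilinForm ℂ V :=
  (if s = 1 then ∑ i, t i • b i else 0)
    + if h : s ∈ admissible G then c ⟨s, h⟩ • Ω.form ⟨s, h⟩ else 0

theorem kappa_eq_sum [Fintype G] (v w : V) :
    kappa G b t Ω c v w = ∑ s : G, MonoidAlgebra.single s (kappaCoeff b t Ω c s v w) := by
  classical
  simp only [kappaCoeff, LinearMap.add_apply, MonoidAlgebra.single_add, Finset.sum_add_distrib]
  rw [kappa]
  congr 1
  · rw [Finset.sum_eq_single_of_mem (1 : G) (Finset.mem_univ 1)]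
    · simp
    · intro s _ hs
      simp [hs]
  · rw [finsum_eq_sum_of_fintype]
    rw [← Finset.sum_filter_of_ne (p := (· ∈ admissible G)),
      Finset.sum_subtype (p := (· ∈ admissible G)) _ (by simp)]
    · refine Finset.sum_congr rfl fun s _ => ?_
      rw [dif_pos s.2]
      rfl
    · intro s _ hs
      by_contra h
      simp [h] at hs

variable {b c}

theorem isGroupBracket_kappaCoeff (hb : ∀ i, b i ∈ invariantForms G)
    (hc : ∀ s s₁ : admissible G, IsConj (s : G) (s₁ : G) → c s = c s₁) :
    IsGroupBracket (kappaCoeff b t Ω c) where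
  alt s v := by
    have h1 : ∀ i, b i v v = 0 := fun i => (hb i).1 v
    have h2 : ∀ s, Ω.form s v v = 0 := fun s => Ω.isAlt s v
    rw [kappaCoeff]
    split_ifs <;> simp [h1, h2]
  conj g s v w := by
    have h0 : g⁻¹ * s * g = 1 ↔ s = 1 := by
      rw [mul_assoc, inv_mul_eq_one, eq_comm, mul_eq_right]
    have h1 : ∀ i, b i (g • v) (g • w) = b i v w := fun i => (hb i).2 g v w
    rw [kappaCoeff, kappaCoeff, LinearMap.add_apply, LinearMap.add_apply, LinearMap.add_apply,
      LinearMap.add_apply]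
    congr 1
    · by_cases hs : s = 1
      · rw [if_pos hs, if_pos (h0.mpr hs)]
        simp [h1]
      · rw [if_neg hs, if_neg (mt h0.mp hs)]
        rfl
    · by_cases hs : s ∈ admissible G
      · have hs' := conj_mem_admissible hs g
        rw [dif_pos hs, dif_pos hs', LinearMap.smul_apply, LinearMap.smul_apply,
          LinearMap.smul_apply, LinearMap.smul_apply, Ω.conj g ⟨s, hs⟩ ⟨_, hs'⟩ rfl,
          hc ⟨_, hs'⟩ ⟨s, hs⟩ (isConj_iff.mpr ⟨g, by group⟩)]
      · rw [dif_neg hs, dif_neg (mt (conj_mem_admissible_iff g).mp hs)]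
        rfl
  jacobi s x y z := by
    by_cases h1 : s = 1
    · simp [h1]
    · by_cases hs : s ∈ admissible G
      · have h2 := jacobi_of_ker_eq_fixedSpace hs.1 (Ω.isAlt ⟨s, hs⟩) (Ω.radical ⟨s, hs⟩) x y z
        simp only [kappaCoeff, if_neg h1, dif_pos hs, zero_add, LinearMap.smul_apply, smul_assoc]
        rw [← smul_add, ← smul_add, h2, smul_zero]
      · simp [kappaCoeff, h1, hs]

end Bracket

end GradedHecke

end

theorem mainTheorem11 {V : Type*} [AddCommGroup V] [Module ℂ V] [FiniteDimensional ℂ V]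
    (G : Subgroup (LinearMap.GeneralLinearGroup ℂ V)) [Finite G]
    (hG : Subgroup.closure (GradedHecke.admissible G) = ⊤)
    {N : ℕ} (b : Module.Basis (Fin N) ℂ (GradedHecke.invariantForms G)) (t : Fin N → ℂ)
    (Ω : GradedHecke.BireflectionForms G)
    (c : GradedHecke.admissible G → ℂ)
    (hc : ∀ s s₁ : GradedHecke.admissible G, IsConj (s : G) (s₁ : G) → c s = c s₁)
    [IsMulCommutative
      (GradedHecke.Spherical G (GradedHecke.kappa G (fun i => (b i).1) t Ω c))] :
    ∃ M : Set (MaximalSpectrum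
        (GradedHecke.Spherical G (GradedHecke.kappa G (fun i => (b i).1) t Ω c))),
      IsOpen M ∧ M.Nonempty ∧
        ∀ m ∈ M, Nonempty
          (GradedHecke.InducedModule G (GradedHecke.kappa G (fun i => (b i).1) t Ω c) m.asIdeal
            ≃ₗ[MonoidAlgebra ℂ G] MonoidAlgebra ℂ G) := by
  have := Fintype.ofFinite G
  have hK := GradedHecke.isGroupBracket_kappaCoeff t Ω (fun i => (b i).2) hc
  have h := GradedHecke.isDeformation_leftIdealEquiv (Module.finBasis ℂ V)
    (GradedHecke.kappa_eq_sum (fun i => (b i).1) t Ω c) hK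
  obtain ⟨ξ, hξ⟩ := GradedHecke.exists_free_orbit (G := G) (Module.finBasis ℂ V)
  obtain ⟨f, hf0, hf⟩ := h.exists_regular_fibres (GradedHecke.isLinearAction_symAct _) hξ
  refine ⟨{m | f ∉ m.asIdeal}, ?_, h.exists_maximal_notMem hf0, fun m hm => ?_⟩
  · exact (PrimeSpectrum.basicOpen f).isOpen.preimage
      MaximalSpectrum.toPrimeSpectrum_continuous
  · obtain ⟨z, hz⟩ := hf m.asIdeal m.isMaximal hm
    let z' : GradedHecke.InducedModule G (GradedHecke.kappa G (fun i => (b i).1) t Ω c) m.asIdeal :=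
      z
    exact ⟨(LinearEquiv.ofBijective (LinearMap.toSpanSingleton (MonoidAlgebra ℂ G) _ z') hz).symm⟩
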